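/- Let $(\mathfrak p_j)_{j\in\mathbb N}$ be a standard effective enumeration of the rational $*$-polynomials, i.e. of the free $*$-algebra without unit over $\mathbb Q(i)$ generated by indeterminates $x_0,x_1,\dots$; fix standard codings by natural numbers of tuples of rational and natural numbers, and of finite subsets of $\mathbb N$. A \emph{presentation} $A^\#=(A,(u_m)_{m\in\mathbb N})$ of a $C^*$-algebra $A$ is a sequence $(u_m)_{m\in\mathbb N}$ in $A$ that generates a dense (not necessarily unital) $*$-subalgebra of $A$. Write $\mathfrak p_j[A^\#]$ for the vector obtained from $\mathfrak p_j$ by substituting $u_m$ for $x_m$ for all $m$. A \emph{name} of $A^\#$ is a function $f\in\mathbb N^{\mathbb N}$ that enumerates (codes of) exactly the triples $(r,j,r')$ with $j\in\mathbb N$, $r,r'\in\mathbb Q\cap(0,\infty)$ and $r<\|\mathfrak p_j[A^\#]\|<r'$. A \emph{presentation} $X^\#=(X,d,(s_j)_{j\in\mathbb N})$ of a Polish space $X$ consists of a complete metric $d$ that is compatible with the topology of $X$ and a dense sequence $(s_j)_{j\in\mathbb N}$ in $X$. A \emph{name} of $X^\#$ is a function $g\in\mathbb N^{\mathbb N}$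 that enumerates (codes of) exactly the tuples $(r,j,k,r')$ with $j,k\in\mathbb N$, $r,r'\in\mathbb Q$ and $r<d(s_j,s_k)<r'$. A \emph{total boundedness function} of $X^\#$ is a function $h\in\mathbb N^{\mathbb N}$ such that for every $j\in\mathbb N$, $h(j)$ is a code of a finite set $F\subseteq\mathbb N$ with $X=\bigcup_{k\in F}B(s_k;2^{-j})$, where $B(s;r)$ is the open ball with respect to $d$. The spectrum $\Delta(A)$ of a commutative unital $C^*$-algebra $A$ is the set of nonzero homomorphisms $A\to\mathbb C$ with the Gelfand topology. \textbf{Theorem.} There is a single oracle Turing machine with the following behaviour. Whenever $A$ is a commutative unital $C^*$-algebra whose spectrum $\Delta(A)$ has finitely many connected components, $n$ is the number of connected components of $\Delta(A)$, and $f$ is a name of a presentation $A^\#$ of $A$, the machine with oracle $f$ and input $n$ computes functions $g,h\in\mathbb N^{\mathbb N}$ (that is, on input $(n,k)$ it halts with output $(g(k),h(k))$, for every $k\in\mathbb N$) such that, for some presentation $\Delta(A)^\#$ of $\Delta(A)$, $g$ is a name of $\Delta(A)^\#$ and $h$ is a total boundedness function of $\Delta(A)^\#$. -/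

import Mathlib

/-! ## Oracle computation -/

/-- Programs of oracle machines on natural numbers: the codes for the partial functions recursive
in an oracle `f : ℕ → ℕ`. They are Mathlib's `Nat.Partrec.Code` together with an oracle query. -/
inductive OracleCode : Type
  | zero : OracleCode
  | succ : OracleCode
  | left : OracleCode
  | right : OracleCode
  | oracle : OracleCode
  | pair : OracleCode → OracleCode → OracleCode
  | comp : OracleCode → OracleCode → OracleCode
  | prec : OracleCode → OracleCode → OracleCode
  | rfind : OracleCode → OracleCode

namespace OracleCode

/-- `c.eval f n` is the output, if any, of the machine `c` with oracle `f` on input `n`. -/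
def eval (f : ℕ → ℕ) : OracleCode → ℕ →. ℕ
  | zero => fun _ => Part.some 0
  | succ => fun n => Part.some (n + 1)
  | left => fun n => Part.some n.unpair.1
  | right => fun n => Part.some n.unpair.2
  | oracle => fun n => Part.some (f n)
  | pair c d => fun n => Nat.pair <$> eval f c n <*> eval f d n
  | comp c d => fun n => eval f d n >>= eval f c
  | prec c d => fun p =>
      p.unpair.2.rec (eval f c p.unpair.1) fun y IH => do
        let i ← IH
        eval f d (Nat.pair p.unpair.1 (Nat.pair y i))
  | rfind c => fun a => Nat.rfind fun n => (fun m => decide (m = 0)) <$> eval f c (Nat.pair a n)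

/-- For a fixed oracle, the programs compute exactly the functions recursive in that oracle. -/
theorem exists_eval_eq_iff (f : ℕ → ℕ) (g : ℕ →. ℕ) :
    (∃ c : OracleCode, c.eval f = g) ↔ Nat.RecursiveIn {(f : ℕ →. ℕ)} g := by
  constructor
  · rintro ⟨c, rfl⟩
    induction c with
    | zero => exact .zero
    | succ => exact .succ
    | left => exact .left
    | right => exact .right
    | oracle => exact .oracle _ rfl
    | pair c d hc hd => exact .pair hc hd
    | comp c d hc hd => exact .comp hc hd
    | prec c d hc hd => exact .prec hc hd
    | rfind c hc => exact .rfind hc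
  · intro h
    induction h with
    | zero => exact ⟨zero, rfl⟩
    | succ => exact ⟨succ, rfl⟩
    | left => exact ⟨left, rfl⟩
    | right => exact ⟨right, rfl⟩
    | oracle g hg => exact ⟨oracle, by rw [Set.mem_singleton_iff.1 hg]; rfl⟩
    | pair _ _ hc hd =>
      obtain ⟨c, rfl⟩ := hc
      obtain ⟨d, rfl⟩ := hd
      exact ⟨pair c d, rfl⟩
    | comp _ _ hc hd =>
      obtain ⟨c, rfl⟩ := hc
      obtain ⟨d, rfl⟩ := hd
      exact ⟨comp c d, rfl⟩
    | prec _ _ hc hd =>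
      obtain ⟨c, rfl⟩ := hc
      obtain ⟨d, rfl⟩ := hd
      exact ⟨prec c d, rfl⟩
    | rfind _ hc =>
      obtain ⟨c, rfl⟩ := hc
      exact ⟨rfind c, rfl⟩

end OracleCode

/-! ## Codes -/

/-- The rational number with code `⟨⟨a, b⟩, c⟩`, namely `(a - b) / (c + 1)`. -/
def ratOfCode (n : ℕ) : ℚ :=
  ((n.unpair.1.unpair.1 : ℚ) - (n.unpair.1.unpair.2 : ℚ)) / ((n.unpair.2 : ℚ) + 1)

/-- Every rational number has a code. -/
theorem ratOfCode_surjective : Function.Surjective ratOfCode := by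
  intro q
  refine ⟨Nat.pair (Nat.pair q.num.toNat (-q.num).toNat) (q.den - 1), ?_⟩
  have h1 : ((q.num.toNat : ℚ)) - (((-q.num).toNat : ℕ) : ℚ) = (q.num : ℚ) := by
    have h : ((q.num.toNat : ℤ)) - (((-q.num).toNat : ℕ) : ℤ) = q.num := by omega
    exact_mod_cast h
  have h2 : ((q.den - 1 : ℕ) : ℚ) + 1 = (q.den : ℚ) := by
    have h : q.den - 1 + 1 = q.den := Nat.sub_add_cancel q.pos
    exact_mod_cast h
  simp only [ratOfCode, Nat.unpair_pair]
  rw [h1, h2, Rat.num_div_den]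

/-- The triple `(r, j, r')` of two rational numbers and an index that is coded by `⟨r, ⟨j, r'⟩⟩`. -/
def tripleOfCode (n : ℕ) : ℚ × ℕ × ℚ :=
  (ratOfCode n.unpair.1, n.unpair.2.unpair.1, ratOfCode n.unpair.2.unpair.2)

/-- The tuple `(r, j, k, r')` of two rational numbers and two indices that is coded by
`⟨r, ⟨⟨j, k⟩, r'⟩⟩`. -/
def quadrupleOfCode (n : ℕ) : ℚ × ℕ × ℕ × ℚ :=
  (ratOfCode n.unpair.1, n.unpair.2.unpair.1.unpair.1, n.unpair.2.unpair.1.unpair.2,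
    ratOfCode n.unpair.2.unpair.2)

/-! ## Presentations of C⋆-algebras -/

/-- A presentation of a C⋆-algebra `A`: a sequence of vectors that generates a dense
⋆-subalgebra. The generated subalgebra need not contain a unit. -/
structure CStarPresentation (A : Type*) [NonUnitalCStarAlgebra A] where
  gen : ℕ → A
  dense : Dense (NonUnitalStarAlgebra.adjoin ℂ (Set.range gen) : Set A)

/-- A letter of the free ⋆-algebra: `(m, false)` is the indeterminate `x_m`, and `(m, true)` is
its adjoint `x_m⋆`. -/
abbrev StarLetter : Type := ℕ × Bool

/-- A (nonempty) word in the letters: its first letter and the list of the remaining ones. -/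
abbrev StarWord : Type := StarLetter × List StarLetter

/-- A formal sum of terms `(a + b i) w`, with `w` a word and with the rational numbers `a` and `b`
given by codes. These represent the elements of the free ⋆-algebra without unit generated by
`x_0, x_1, …` over `ℚ(i)`: the sum of two elements is represented by concatenation, and products and
adjoints are formed termwise. -/
abbrev RatStarPoly : Type := List ((ℕ × ℕ) × StarWord)

/-- The `j`-th rational ⋆-polynomial. -/
def ratStarPoly (j : ℕ) : RatStarPoly :=
  (Encodable.decode (α := RatStarPoly) j).getD []

section Evaluation

variable {A : Type*} [NonUnitalCStarAlgebra A]

/-- The vector obtained from a letter by substituting `u m` for `x_m`. -/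
def evalLetter (u : ℕ → A) (s : StarLetter) : A :=
  if s.2 then star (u s.1) else u s.1

/-- The vector obtained from a word by substitution: the product of its letters, in order. -/
def evalWord (u : ℕ → A) (w : StarWord) : A :=
  w.2.foldl (fun a s => a * evalLetter u s) (evalLetter u w.1)

/-- The vector obtained from a rational ⋆-polynomial by substituting `u m` for `x_m`. -/
noncomputable def evalRatStarPoly (u : ℕ → A) (p : RatStarPoly) : A :=
  (p.map fun t =>
    ((ratOfCode t.1.1 : ℂ) + (ratOfCode t.1.2 : ℂ) * Complex.I) • evalWord u t.2).sum

namespace CStarPresentation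

/-- The `j`-th rational vector of a presentation. -/
noncomputable def ratVector (P : CStarPresentation A) (j : ℕ) : A :=
  evalRatStarPoly P.gen (ratStarPoly j)

/-- The diagram of a presentation: all `(r, j, r')` with `r, r'` positive rational numbers such that
`r < ‖v‖ < r'`, where `v` is the `j`-th rational vector. -/
def diagram (P : CStarPresentation A) : Set (ℚ × ℕ × ℚ) :=
  {t | 0 < t.1 ∧ 0 < t.2.2 ∧ (t.1 : ℝ) < ‖P.ratVector t.2.1‖ ∧ ‖P.ratVector t.2.1‖ < (t.2.2 : ℝ)}

/-- A name of a presentation: an enumeration (of codes) of its diagram. -/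
def IsName (P : CStarPresentation A) (f : ℕ → ℕ) : Prop :=
  P.diagram = Set.range fun k => tripleOfCode (f k)

end CStarPresentation

end Evaluation

/-! ## Presentations of Polish spaces -/

/-- A presentation of a Polish space `X`: a complete metric that is compatible with the topology
of `X`, and a dense sequence of points. -/
structure PolishPresentation (X : Type*) [τ : TopologicalSpace X] where
  metric : MetricSpace X
  compatible : metric.toPseudoMetricSpace.toUniformSpace.toTopologicalSpace = τ
  complete : @CompleteSpace X metric.toPseudoMetricSpace.toUniformSpace
  point : ℕ → X
  dense : @DenseRange X τ ℕ point

namespace PolishPresentation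

variable {X : Type*} [TopologicalSpace X]

/-- The distance of the metric that belongs to the presentation. -/
def distance (Q : PolishPresentation X) (x y : X) : ℝ :=
  Q.metric.toPseudoMetricSpace.toDist.dist x y

/-- The diagram of a presentation: all `(r, j, k, r')` with `r, r'` rational numbers such that
`r < d(s_j, s_k) < r'`. -/
def diagram (Q : PolishPresentation X) : Set (ℚ × ℕ × ℕ × ℚ) :=
  {t | (t.1 : ℝ) < Q.distance (Q.point t.2.1) (Q.point t.2.2.1) ∧
    Q.distance (Q.point t.2.1) (Q.point t.2.2.1) < (t.2.2.2 : ℝ)}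

/-- A name of a presentation: an enumeration (of codes) of its diagram. -/
def IsName (Q : PolishPresentation X) (g : ℕ → ℕ) : Prop :=
  Q.diagram = Set.range fun k => quadrupleOfCode (g k)

/-- A total boundedness function: `h j` is the code of a finite set `F` of natural numbers such that
the open balls of radius `2 ^ (-j)` around the points `s_k`, `k ∈ F`, cover the space. The code of
`F` is the number whose binary digits equal to `1` are in the positions `k ∈ F`. -/
def IsTotalBoundednessFunction (Q : PolishPresentation X) (h : ℕ → ℕ) : Prop :=
  ∀ j : ℕ, ∀ x : X, ∃ k ∈ Finset.equivBitIndices (h j), Q.distance x (Q.point k) < (2 ^ j : ℝ)⁻¹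

end PolishPresentation

/-! ## Uniform computability relative to a family of oracles -/

namespace OracleCode

/-! By Gelfand duality the norm of `A` is the sup norm on the spectrum, so norms of rational vectors
carry information about points of the spectrum. Uniformity is obtained by treating all named
algebras as one indexed family: `UniformComputable` asks for a single program for the whole family.
Nearly every algorithm is an unbounded search for a candidate that passes a decidable test. Passing
certifies correctness, and a separate argument shows that some candidate passes.

The number `n` of components is needed only to find the unit, which need not be a rational vector.
Approximate projections `q 0, …, q n`, each dominated by the next and at distance more than `1 / 2`
from it, define a strictly increasing chain of clopen subsets of the spectrum. A clopen set is a
union of components, so `n` strict steps exhaust the spectrum and `q n` is close to `1`. Indicators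
of unions of components show that such a chain exists (`norm_sub_one_le_of_chain`,
`exists_projection_chain`, `exists_unit_approx`).

With the unit, the minimum of a real-valued rational vector `a` bounded by `B` is computable as `B -
‖B • 1 - a‖` (`exists_min_approx`). The real and imaginary parts of the generators embed the
spectrum in the space of real sequences. Applied to a sum of squares, the minimum tells up to a
factor whether a finite rational sequence is close to the coordinates of some point
(`exists_isGood`). Such sequences are refined again and again, and compactness supplies the limit
points `s k` (`exists_points`). Distances come from finitely many coordinates. A point close to any
given one starts from a rational sequence whose code has a computable bound, which makes all indices
below a computable bound an explicit net (`exists_index_bound`). -/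

theorem exists_eval_eq_of_partrec {g : ℕ →. ℕ} (hg : Nat.Partrec g) :
    ∃ c : OracleCode, ∀ f, c.eval f = g := by
  induction hg with
  | zero => exact ⟨zero, fun _ => rfl⟩
  | succ => exact ⟨succ, fun _ => rfl⟩
  | left => exact ⟨left, fun _ => rfl⟩
  | right => exact ⟨right, fun _ => rfl⟩
  | pair _ _ hc hd =>
    obtain ⟨c, hc⟩ := hc
    obtain ⟨d, hd⟩ := hd
    exact ⟨pair c d, fun f => by rw [← hc f, ← hd f]; rfl⟩
  | comp _ _ hc hd =>
    obtain ⟨c, hc⟩ := hc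
    obtain ⟨d, hd⟩ := hd
    exact ⟨comp c d, fun f => by rw [← hc f, ← hd f]; rfl⟩
  | prec _ _ hc hd =>
    obtain ⟨c, hc⟩ := hc
    obtain ⟨d, hd⟩ := hd
    exact ⟨prec c d, fun f => by rw [← hc f, ← hd f]; rfl⟩
  | rfind _ hc =>
    obtain ⟨c, hc⟩ := hc
    exact ⟨rfind c, fun f => by rw [← hc f]; rfl⟩

variable {f : ℕ → ℕ} {c d : OracleCode} {n a b : ℕ}

theorem eval_pair_eq_some (hc : c.eval f n = Part.some a) (hd : d.eval f n = Part.some b) :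
    (pair c d).eval f n = Part.some (Nat.pair a b) := by
  simp [eval, hc, hd, Seq.seq]

theorem eval_comp_eq_some (hd : d.eval f n = Part.some a) (hc : c.eval f a = Part.some b) :
    (comp c d).eval f n = Part.some b := by
  change (d.eval f n).bind (c.eval f) = _
  rw [hd]
  exact (Part.bind_some _ _).trans hc

theorem eval_prec_pair_zero (f : ℕ → ℕ) (c d : OracleCode) (a : ℕ) :
    (prec c d).eval f (Nat.pair a 0) = c.eval f a := by
  simp [eval]

theorem eval_prec_pair_succ {k r : ℕ} (hk : (prec c d).eval f (Nat.pair a k) = Part.some r)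
    (hr : d.eval f (Nat.pair a (Nat.pair k r)) = Part.some b) :
    (prec c d).eval f (Nat.pair a (k + 1)) = Part.some b := by
  have h : (prec c d).eval f (Nat.pair a (k + 1)) = ((prec c d).eval f (Nat.pair a k)).bind
      fun r => d.eval f (Nat.pair a (Nat.pair k r)) := by
    simp [eval]
  rw [h, hk, Part.bind_some, hr]

theorem eval_rfind_eq_some {u : ℕ → ℕ} {k : ℕ}
    (hc : ∀ m, c.eval f (Nat.pair a m) = Part.some (u m)) (hk : u k = 0)
    (hm : ∀ m < k, u m ≠ 0) : (rfind c).eval f a = Part.some k := by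
  change Nat.rfind (fun m => (c.eval f (Nat.pair a m)).map fun m => decide (m = 0)) = _
  have h : ∀ m, (c.eval f (Nat.pair a m)).map (fun m => decide (m = 0)) =
      Part.some (decide (u m = 0)) := fun m => by rw [hc, Part.map_some]
  refine Part.eq_some_iff.2 (Nat.mem_rfind.2 ⟨?_, fun {m} hmk => ?_⟩)
  · rw [h, hk]; simp
  · rw [h, decide_eq_false (hm m hmk)]; simp

theorem eval_left_pair (f : ℕ → ℕ) (a b : ℕ) :
    left.eval f (Nat.pair a b) = Part.some a := by simp [eval]

theorem eval_right_pair (f : ℕ → ℕ) (a b : ℕ) :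
    right.eval f (Nat.pair a b) = Part.some b := by simp [eval]

/-- The program that rearranges `⟨⟨n, x⟩, k⟩` to `⟨n, ⟨x, k⟩⟩`. -/
def assoc : OracleCode := pair (comp left left) (pair (comp right left) right)

theorem eval_assoc (f : ℕ → ℕ) (n x k : ℕ) :
    assoc.eval f (Nat.pair (Nat.pair n x) k) = Part.some (Nat.pair n (Nat.pair x k)) :=
  eval_pair_eq_some
    (eval_comp_eq_some (eval_left_pair _ _ _) (eval_left_pair _ _ _))
    (eval_pair_eq_some (eval_comp_eq_some (eval_left_pair _ _ _) (eval_right_pair _ _ _))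
      (eval_right_pair _ _ _))

end OracleCode

open Encodable in
/-- A family of functions `Φ i` is uniformly computable relative to the oracles `orc i` and the
numerical parameters `prm i` if a single program computes all of them. -/
def UniformComputable {ι : Type*} (orc : ι → ℕ → ℕ) (prm : ι → ℕ) {α β : Type*} [Primcodable α]
    [Primcodable β] (Φ : ι → α → β) : Prop :=
  ∃ c : OracleCode, ∀ i a,
    c.eval (orc i) (Nat.pair (prm i) (encode a)) = Part.some (encode (Φ i a))

namespace UniformComputable

open Encodable OracleCode

variable {ι : Type*} {orc : ι → ℕ → ℕ} {prm : ι → ℕ}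
variable {α β γ δ : Type*} [Primcodable α] [Primcodable β] [Primcodable γ] [Primcodable δ]

theorem of_computable {f : α → β} (hf : Computable f) :
    UniformComputable orc prm fun _ => f := by
  obtain ⟨c, hc⟩ := exists_eval_eq_of_partrec hf
  refine ⟨comp c right, fun i a => eval_comp_eq_some (eval_right_pair _ _ _) ?_⟩
  simp [hc]

theorem comp {Φ : ι → β → γ} {Ψ : ι → α → β} (hΦ : UniformComputable orc prm Φ)
    (hΨ : UniformComputable orc prm Ψ) : UniformComputable orc prm fun i a => Φ i (Ψ i a) := by
  obtain ⟨c, hc⟩ := hΦ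
  obtain ⟨d, hd⟩ := hΨ
  exact ⟨.comp c (.pair left d), fun i a => eval_comp_eq_some
    (eval_pair_eq_some (eval_left_pair _ _ _) (hd i a)) (hc i _)⟩

theorem pair {Φ : ι → α → β} {Ψ : ι → α → γ} (hΦ : UniformComputable orc prm Φ)
    (hΨ : UniformComputable orc prm Ψ) : UniformComputable orc prm fun i a => (Φ i a, Ψ i a) := by
  obtain ⟨c, hc⟩ := hΦ
  obtain ⟨d, hd⟩ := hΨ
  exact ⟨.pair c d, fun i a => eval_pair_eq_some (hc i a) (hd i a)⟩

theorem map {f : β → γ} {Φ : ι → α → β} (hf : Computable f) (hΦ : UniformComputable orc prm Φ) :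
    UniformComputable orc prm fun i a => f (Φ i a) :=
  (of_computable hf).comp hΦ

theorem map₂ {f : β → γ → δ} {Φ : ι → α → β} {Ψ : ι → α → γ} (hf : Computable₂ f)
    (hΦ : UniformComputable orc prm Φ) (hΨ : UniformComputable orc prm Ψ) :
    UniformComputable orc prm fun i a => f (Φ i a) (Ψ i a) :=
  (of_computable hf).comp (hΦ.pair hΨ)

protected theorem id : UniformComputable orc prm fun _ (a : α) => a := of_computable Computable.id

theorem const (b : β) : UniformComputable orc prm fun _ (_ : α) => b :=
  of_computable (Computable.const b)

theorem fst {Φ : ι → α → β × γ} (hΦ : UniformComputable orc prm Φ) :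
    UniformComputable orc prm fun i a => (Φ i a).1 := hΦ.map Computable.fst

theorem snd {Φ : ι → α → β × γ} (hΦ : UniformComputable orc prm Φ) :
    UniformComputable orc prm fun i a => (Φ i a).2 := hΦ.map Computable.snd

theorem unpairFst {Φ : ι → α → ℕ} (hΦ : UniformComputable orc prm Φ) :
    UniformComputable orc prm fun i a => (Φ i a).unpair.1 :=
  hΦ.map (f := fun n => n.unpair.1) (Primrec.fst.comp Primrec.unpair).to_comp

theorem unpairSnd {Φ : ι → α → ℕ} (hΦ : UniformComputable orc prm Φ) :
    UniformComputable orc prm fun i a => (Φ i a).unpair.2 :=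
  hΦ.map (f := fun n => n.unpair.2) (Primrec.snd.comp Primrec.unpair).to_comp

theorem natEq {Φ Ψ : ι → α → ℕ} (hΦ : UniformComputable orc prm Φ)
    (hΨ : UniformComputable orc prm Ψ) :
    UniformComputable orc prm fun i a => decide (Φ i a = Ψ i a) :=
  hΦ.map₂ (PrimrecRel.decide Primrec.eq).to_comp hΨ

theorem natPow {Φ Ψ : ι → α → ℕ} (hΦ : UniformComputable orc prm Φ)
    (hΨ : UniformComputable orc prm Ψ) : UniformComputable orc prm fun i a => Φ i a ^ Ψ i a :=
  hΦ.map₂ (Primrec₂.unpaired'.1 Nat.Primrec.pow).to_comp hΨ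

theorem natAdd {Φ Ψ : ι → α → ℕ} (hΦ : UniformComputable orc prm Φ)
    (hΨ : UniformComputable orc prm Ψ) : UniformComputable orc prm fun i a => Φ i a + Ψ i a :=
  hΦ.map₂ Primrec.nat_add.to_comp hΨ

theorem natMul {Φ Ψ : ι → α → ℕ} (hΦ : UniformComputable orc prm Φ)
    (hΨ : UniformComputable orc prm Ψ) : UniformComputable orc prm fun i a => Φ i a * Ψ i a :=
  hΦ.map₂ Primrec.nat_mul.to_comp hΨ

theorem natSub {Φ Ψ : ι → α → ℕ} (hΦ : UniformComputable orc prm Φ)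
    (hΨ : UniformComputable orc prm Ψ) : UniformComputable orc prm fun i a => Φ i a - Ψ i a :=
  hΦ.map₂ Primrec.nat_sub.to_comp hΨ

theorem natPair {Φ Ψ : ι → α → ℕ} (hΦ : UniformComputable orc prm Φ)
    (hΨ : UniformComputable orc prm Ψ) :
    UniformComputable orc prm fun i a => Nat.pair (Φ i a) (Ψ i a) :=
  hΦ.map₂ Primrec₂.natPair.to_comp hΨ

theorem oracle {Φ : ι → α → ℕ} (hΦ : UniformComputable orc prm Φ) :
    UniformComputable orc prm fun i a => orc i (Φ i a) :=
  comp (Φ := fun i k => orc i k)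
    ⟨.comp .oracle right, fun _ _ => eval_comp_eq_some (eval_right_pair _ _ _) rfl⟩ hΦ

theorem param : UniformComputable orc prm fun i (_ : α) => prm i :=
  ⟨left, fun _ _ => eval_left_pair _ _ _⟩

/-- `prec` carries a single parameter, so the number `prm i` and the code of the argument are packed
together. The step program then receives `⟨⟨n, a⟩, ⟨k, r⟩⟩`, which `assoc` turns into the expected
`⟨n, ⟨a, ⟨k, r⟩⟩⟩`. -/
theorem natRec {Φ : ι → α → β} {Ψ : ι → α × ℕ × β → β} (hΦ : UniformComputable orc prm Φ)
    (hΨ : UniformComputable orc prm Ψ) :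
    UniformComputable orc prm fun i (p : α × ℕ) =>
      (p.2.rec (Φ i p.1) fun k r => Ψ i (p.1, k, r) : β) := by
  obtain ⟨c, hc⟩ := hΦ
  obtain ⟨d, hd⟩ := hΨ
  refine ⟨.comp (prec c (.comp d assoc))
    (.pair (.pair left (.comp left right)) (.comp right right)), fun i p => ?_⟩
  obtain ⟨a, k⟩ := p
  refine eval_comp_eq_some (eval_pair_eq_some (eval_pair_eq_some (eval_left_pair _ _ _)
    (eval_comp_eq_some (eval_right_pair _ _ _) (eval_left_pair _ _ _)))
    (eval_comp_eq_some (eval_right_pair _ _ _) (eval_right_pair _ _ _))) ?_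
  induction k with
  | zero => exact (eval_prec_pair_zero _ _ _ _).trans (hc i a)
  | succ k ih =>
    exact eval_prec_pair_succ ih (eval_comp_eq_some (eval_assoc _ _ _ _) (hd i (a, k, _)))

/-- `rfind` looks for a zero and `false` is encoded by `0`, so the program evaluates the negated
test. Totality of the search is the hypothesis `H`. -/
theorem find {p : ι → α × ℕ → Bool} (hp : UniformComputable orc prm p)
    (H : ∀ i a, ∃ k, p i (a, k) = true) : UniformComputable orc prm fun i a => Nat.find (H i a) := by
  obtain ⟨c, hc⟩ := hp.map (f := not) (Primrec.not.to_comp)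
  refine ⟨rfind (.comp c assoc), fun i a => ?_⟩
  refine eval_rfind_eq_some (u := fun k => encode (!p i (a, k)))
    (fun k => eval_comp_eq_some (eval_assoc _ _ _ _) (hc i (a, k))) ?_ fun m hm => ?_
  · change encode (!p i (a, Nat.find (H i a))) = 0
    rw [Nat.find_spec (H i a)]; rfl
  · rw [Bool.eq_false_of_not_eq_true (Nat.find_min (H i a) hm)]; decide

/-- The form in which searches are used below: only the fact that the answer passes the test is
remembered, not its minimality. -/
theorem exists_choice {p : ι → α × ℕ → Bool} (hp : UniformComputable orc prm p)
    (H : ∀ i a, ∃ k, p i (a, k) = true) :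
    ∃ Φ : ι → α → ℕ, UniformComputable orc prm Φ ∧ ∀ i a, p i (a, Φ i a) = true :=
  ⟨_, find hp H, fun i a => Nat.find_spec (H i a)⟩

theorem and {p q : ι → α → Bool} (hp : UniformComputable orc prm p)
    (hq : UniformComputable orc prm q) : UniformComputable orc prm fun i a => p i a && q i a :=
  hp.map₂ (f := Bool.and) Primrec.and.to_comp hq

theorem or {p q : ι → α → Bool} (hp : UniformComputable orc prm p)
    (hq : UniformComputable orc prm q) : UniformComputable orc prm fun i a => p i a || q i a :=
  hp.map₂ (f := Bool.or) Primrec.or.to_comp hq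

theorem not {p : ι → α → Bool} (hp : UniformComputable orc prm p) :
    UniformComputable orc prm fun i a => !p i a :=
  hp.map Primrec.not.to_comp

theorem ite {p : ι → α → Bool} {Φ Ψ : ι → α → β} (hp : UniformComputable orc prm p)
    (hΦ : UniformComputable orc prm Φ) (hΨ : UniformComputable orc prm Ψ) :
    UniformComputable orc prm fun i a => if p i a then Φ i a else Ψ i a := by
  have h : Computable fun t : Bool × β × β => if t.1 then t.2.1 else t.2.2 := by
    refine (Computable.cond Computable.fst (Computable.fst.comp Computable.snd)
      (Computable.snd.comp Computable.snd)).of_eq fun t => ?_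
    cases t.1 <;> rfl
  exact (hp.pair (hΦ.pair hΨ)).map h

/-- Bounded universal quantification. -/
theorem forall_lt {p : ι → α × ℕ → Bool} {N : ι → α → ℕ} (hp : UniformComputable orc prm p)
    (hN : UniformComputable orc prm N) :
    UniformComputable orc prm fun i a => decide (∀ l < N i a, p i (a, l) = true) := by
  have h := natRec (const (α := α) true : UniformComputable orc prm _)
    (Ψ := fun i (t : α × ℕ × Bool) => p i (t.1, t.2.1) && t.2.2)
    ((hp.comp (UniformComputable.id.fst.pair UniformComputable.id.snd.fst)).and
      UniformComputable.id.snd.snd)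
  have e : ∀ i a n, (Nat.rec true (fun l r => p i (a, l) && r) n : Bool) =
      decide (∀ l < n, p i (a, l) = true) := by
    intro i a n
    induction n with
    | zero => simp
    | succ n ih =>
      simp only [Nat.forall_lt_succ_right, Bool.decide_and, Bool.decide_eq_true]
      rw [ih, Bool.and_comm]
  convert h.comp (UniformComputable.id.pair hN) using 3 with i a
  exact (e _ _ _).symm

end UniformComputable

/-! ## Arithmetic on codes of rational numbers -/

namespace RatCode

/-- A code of the sum of two rational numbers. -/
def add (x y : ℕ) : ℕ :=
  Nat.pair (Nat.pair
    (x.unpair.1.unpair.1 * (y.unpair.2 + 1) + y.unpair.1.unpair.1 * (x.unpair.2 + 1))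
    (x.unpair.1.unpair.2 * (y.unpair.2 + 1) + y.unpair.1.unpair.2 * (x.unpair.2 + 1)))
    (x.unpair.2 * y.unpair.2 + x.unpair.2 + y.unpair.2)

/-- A code of the product of two rational numbers. -/
def mul (x y : ℕ) : ℕ :=
  Nat.pair (Nat.pair
    (x.unpair.1.unpair.1 * y.unpair.1.unpair.1 + x.unpair.1.unpair.2 * y.unpair.1.unpair.2)
    (x.unpair.1.unpair.1 * y.unpair.1.unpair.2 + x.unpair.1.unpair.2 * y.unpair.1.unpair.1))
    (x.unpair.2 * y.unpair.2 + x.unpair.2 + y.unpair.2)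

/-- A code of the negative of a rational number. -/
def neg (x : ℕ) : ℕ :=
  Nat.pair (Nat.pair x.unpair.1.unpair.2 x.unpair.1.unpair.1) x.unpair.2

/-- The code of the quotient `a / (c + 1)` of natural numbers. -/
def divSucc (a c : ℕ) : ℕ := Nat.pair (Nat.pair a 0) c

/-- The comparison of two rational numbers. -/
def lt (x y : ℕ) : Bool :=
  decide (x.unpair.1.unpair.1 * (y.unpair.2 + 1) + y.unpair.1.unpair.2 * (x.unpair.2 + 1) <
    y.unpair.1.unpair.1 * (x.unpair.2 + 1) + x.unpair.1.unpair.2 * (y.unpair.2 + 1))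

/-- A code stores the denominator minus one, and `c * d + c + d` is one less than `(c + 1) * (d +
1)`. -/
theorem ratOfCode_add (x y : ℕ) : ratOfCode (add x y) = ratOfCode x + ratOfCode y := by
  have hx : (x.unpair.2 : ℚ) + 1 ≠ 0 := by positivity
  have hy : (y.unpair.2 : ℚ) + 1 ≠ 0 := by positivity
  have h : (x.unpair.2 : ℚ) * y.unpair.2 + x.unpair.2 + y.unpair.2 + 1 =
    (x.unpair.2 + 1) * (y.unpair.2 + 1) := by ring
  simp only [ratOfCode, add, Nat.unpair_pair]
  push_cast
  rw [h]
  field_simp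
  ring

theorem ratOfCode_mul (x y : ℕ) : ratOfCode (mul x y) = ratOfCode x * ratOfCode y := by
  have hx : (x.unpair.2 : ℚ) + 1 ≠ 0 := by positivity
  have hy : (y.unpair.2 : ℚ) + 1 ≠ 0 := by positivity
  have h : (x.unpair.2 : ℚ) * y.unpair.2 + x.unpair.2 + y.unpair.2 + 1 =
    (x.unpair.2 + 1) * (y.unpair.2 + 1) := by ring
  simp only [ratOfCode, mul, Nat.unpair_pair]
  push_cast
  rw [h]
  field_simp
  ring

theorem ratOfCode_neg (x : ℕ) : ratOfCode (neg x) = -ratOfCode x := by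
  simp only [ratOfCode, neg, Nat.unpair_pair]
  ring

theorem ratOfCode_divSucc (a c : ℕ) : ratOfCode (divSucc a c) = a / ((c : ℚ) + 1) := by
  simp [ratOfCode, divSucc]

theorem lt_eq_decide (x y : ℕ) : lt x y = decide (ratOfCode x < ratOfCode y) := by
  have hx : (0 : ℚ) < (x.unpair.2 : ℚ) + 1 := by positivity
  have hy : (0 : ℚ) < (y.unpair.2 : ℚ) + 1 := by positivity
  rw [lt, decide_eq_decide, ratOfCode, ratOfCode, div_lt_div_iff₀ hx hy, ← Nat.cast_lt (α := ℚ)]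
  push_cast
  constructor <;> intro h <;> linarith

section Primrec

open Primrec

theorem primrec_pos : Primrec fun x : ℕ => x.unpair.1.unpair.1 :=
  fst.comp (unpair.comp (fst.comp unpair))

theorem primrec_neg_part : Primrec fun x : ℕ => x.unpair.1.unpair.2 :=
  snd.comp (unpair.comp (fst.comp unpair))

theorem primrec_den : Primrec fun x : ℕ => x.unpair.2 := snd.comp unpair

theorem primrec_den_succ : Primrec fun x : ℕ => x.unpair.2 + 1 := succ.comp primrec_den

theorem primrec_den_mul :
    Primrec₂ fun x y : ℕ => x.unpair.2 * y.unpair.2 + x.unpair.2 + y.unpair.2 :=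
  nat_add.comp (nat_add.comp (nat_mul.comp (primrec_den.comp fst) (primrec_den.comp snd))
    (primrec_den.comp fst)) (primrec_den.comp snd)

theorem primrec_add : Primrec₂ add :=
  Primrec₂.natPair.comp (Primrec₂.natPair.comp
    (nat_add.comp (nat_mul.comp (primrec_pos.comp fst) (primrec_den_succ.comp snd))
      (nat_mul.comp (primrec_pos.comp snd) (primrec_den_succ.comp fst)))
    (nat_add.comp (nat_mul.comp (primrec_neg_part.comp fst) (primrec_den_succ.comp snd))
      (nat_mul.comp (primrec_neg_part.comp snd) (primrec_den_succ.comp fst)))) primrec_den_mul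

theorem primrec_mul : Primrec₂ mul :=
  Primrec₂.natPair.comp (Primrec₂.natPair.comp
    (nat_add.comp (nat_mul.comp (primrec_pos.comp fst) (primrec_pos.comp snd))
      (nat_mul.comp (primrec_neg_part.comp fst) (primrec_neg_part.comp snd)))
    (nat_add.comp (nat_mul.comp (primrec_pos.comp fst) (primrec_neg_part.comp snd))
      (nat_mul.comp (primrec_neg_part.comp fst) (primrec_pos.comp snd)))) primrec_den_mul

theorem primrec_neg : Primrec neg :=
  Primrec₂.natPair.comp (Primrec₂.natPair.comp primrec_neg_part primrec_pos) primrec_den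

theorem primrec_divSucc : Primrec₂ divSucc :=
  Primrec₂.natPair.comp (Primrec₂.natPair.comp fst (.const 0)) snd

theorem primrec_lt : Primrec₂ lt :=
  PrimrecPred.decide (nat_lt.comp
    (nat_add.comp (nat_mul.comp (primrec_pos.comp fst) (primrec_den_succ.comp snd))
      (nat_mul.comp (primrec_neg_part.comp snd) (primrec_den_succ.comp fst)))
    (nat_add.comp (nat_mul.comp (primrec_pos.comp snd) (primrec_den_succ.comp fst))
      (nat_mul.comp (primrec_neg_part.comp fst) (primrec_den_succ.comp snd))))

end Primrec

end RatCode

/-- A family of rational-valued functions is uniformly computable if codes of their values are. -/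
def UniformComputableRat {ι : Type*} (orc : ι → ℕ → ℕ) (prm : ι → ℕ) {α : Type*} [Primcodable α]
    (q : ι → α → ℚ) : Prop :=
  ∃ κ : ι → α → ℕ, UniformComputable orc prm κ ∧ ∀ i a, ratOfCode (κ i a) = q i a

namespace UniformComputableRat

variable {ι : Type*} {orc : ι → ℕ → ℕ} {prm : ι → ℕ}
variable {α β : Type*} [Primcodable α] [Primcodable β]
variable {q r : ι → α → ℚ}

theorem ofCode {κ : ι → α → ℕ} (hκ : UniformComputable orc prm κ) :
    UniformComputableRat orc prm fun i a => ratOfCode (κ i a) := ⟨κ, hκ, fun _ _ => rfl⟩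

theorem divSucc {Φ Ψ : ι → α → ℕ} (hΦ : UniformComputable orc prm Φ)
    (hΨ : UniformComputable orc prm Ψ) :
    UniformComputableRat orc prm fun i a => (Φ i a : ℚ) / ((Ψ i a : ℚ) + 1) :=
  ⟨_, hΦ.map₂ RatCode.primrec_divSucc.to_comp hΨ, fun _ _ => RatCode.ratOfCode_divSucc _ _⟩

theorem natCast {Φ : ι → α → ℕ} (hΦ : UniformComputable orc prm Φ) :
    UniformComputableRat orc prm fun i a => (Φ i a : ℚ) := by
  simpa using hΦ |> divSucc <| .const 0

theorem const (c : ℚ) : UniformComputableRat orc prm fun _ (_ : α) => c := by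
  obtain ⟨n, rfl⟩ := ratOfCode_surjective c
  exact ofCode (.const n)

theorem comp {q : ι → β → ℚ} {Φ : ι → α → β} (hq : UniformComputableRat orc prm q)
    (hΦ : UniformComputable orc prm Φ) : UniformComputableRat orc prm fun i a => q i (Φ i a) := by
  obtain ⟨κ, hκ, h⟩ := hq
  exact ⟨_, hκ.comp hΦ, fun _ _ => h _ _⟩

theorem add (hq : UniformComputableRat orc prm q) (hr : UniformComputableRat orc prm r) :
    UniformComputableRat orc prm fun i a => q i a + r i a := by
  obtain ⟨κ, hκ, h⟩ := hq
  obtain ⟨μ, hμ, h'⟩ := hr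
  exact ⟨_, hκ.map₂ RatCode.primrec_add.to_comp hμ, fun _ _ => by
    rw [RatCode.ratOfCode_add, h, h']⟩

theorem mul (hq : UniformComputableRat orc prm q) (hr : UniformComputableRat orc prm r) :
    UniformComputableRat orc prm fun i a => q i a * r i a := by
  obtain ⟨κ, hκ, h⟩ := hq
  obtain ⟨μ, hμ, h'⟩ := hr
  exact ⟨_, hκ.map₂ RatCode.primrec_mul.to_comp hμ, fun _ _ => by
    rw [RatCode.ratOfCode_mul, h, h']⟩

theorem neg (hq : UniformComputableRat orc prm q) :
    UniformComputableRat orc prm fun i a => -q i a := by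
  obtain ⟨κ, hκ, h⟩ := hq
  exact ⟨_, hκ.map RatCode.primrec_neg.to_comp, fun _ _ => by rw [RatCode.ratOfCode_neg, h]⟩

theorem sub (hq : UniformComputableRat orc prm q) (hr : UniformComputableRat orc prm r) :
    UniformComputableRat orc prm fun i a => q i a - r i a := by
  simpa only [sub_eq_add_neg] using hq.add hr.neg

theorem lt (hq : UniformComputableRat orc prm q) (hr : UniformComputableRat orc prm r) :
    UniformComputable orc prm fun i a => decide (q i a < r i a) := by
  obtain ⟨κ, hκ, h⟩ := hq
  obtain ⟨μ, hμ, h'⟩ := hr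
  simpa only [RatCode.lt_eq_decide, h, h'] using hκ.map₂ RatCode.primrec_lt.to_comp hμ

theorem ite {p : ι → α → Bool} (hp : UniformComputable orc prm p)
    (hq : UniformComputableRat orc prm q) (hr : UniformComputableRat orc prm r) :
    UniformComputableRat orc prm fun i a => if p i a then q i a else r i a := by
  obtain ⟨κ, hκ, h⟩ := hq
  obtain ⟨μ, hμ, h'⟩ := hr
  exact ⟨_, hp.ite hκ hμ, fun i a => by rw [apply_ite ratOfCode, h, h']⟩

theorem min (hq : UniformComputableRat orc prm q) (hr : UniformComputableRat orc prm r) :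
    UniformComputableRat orc prm fun i a => Min.min (q i a) (r i a) := by
  convert ite (lt hq hr) hq hr using 3 with i a
  simp only [decide_eq_true_eq]
  split_ifs with h
  · exact min_eq_left h.le
  · exact min_eq_right (not_lt.1 h)

theorem abs (hq : UniformComputableRat orc prm q) :
    UniformComputableRat orc prm fun i a => |q i a| := by
  convert ite (lt hq (const 0)) hq.neg hq using 3 with i a
  simp only [decide_eq_true_eq]
  split_ifs with h
  · exact abs_of_neg h
  · exact abs_of_nonneg (not_lt.1 h)

theorem sum_range {q : ι → α × ℕ → ℚ} {N : ι → α → ℕ} (hq : UniformComputableRat orc prm q)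
    (hN : UniformComputable orc prm N) :
    UniformComputableRat orc prm fun i a => ∑ l ∈ Finset.range (N i a), q i (a, l) := by
  obtain ⟨κ, hκ, h⟩ := hq
  have hs := UniformComputable.natRec (.const (α := α) 0 : UniformComputable orc prm _)
    (Ψ := fun i (t : α × ℕ × ℕ) => RatCode.add t.2.2 (κ i (t.1, t.2.1)))
    (UniformComputable.id.snd.snd.map₂ RatCode.primrec_add.to_comp
      (hκ.comp (UniformComputable.id.fst.pair UniformComputable.id.snd.fst)))
  refine ⟨_, hs.comp (UniformComputable.id.pair hN), fun i a => ?_⟩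
  dsimp only
  generalize N i a = n
  induction n with
  | zero => simp [ratOfCode]
  | succ n ih =>
    simp only at ih ⊢
    rw [RatCode.ratOfCode_add, ih, h, Finset.sum_range_succ]

end UniformComputableRat

/-! ## Operations on rational ⋆-polynomials -/

/-- The complex number with rational real and imaginary parts given by codes. -/
noncomputable def complexOfCode (c : ℕ × ℕ) : ℂ :=
  (ratOfCode c.1 : ℂ) + (ratOfCode c.2 : ℂ) * Complex.I

theorem ratOfCode_zero : ratOfCode 0 = 0 := by simp [ratOfCode]

theorem denseRange_complexOfCode : DenseRange complexOfCode := by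
  have h : DenseRange fun n => (ratOfCode n : ℝ) :=
    Rat.denseRange_cast.comp ratOfCode_surjective.denseRange Rat.continuous_coe_real
  have h2 := Complex.equivRealProdCLM.symm.surjective.denseRange.comp (h.prodMap h)
    Complex.equivRealProdCLM.symm.continuous
  convert h2 using 1
  ext c
  simp [complexOfCode, Complex.equivRealProdCLM_symm_apply]

namespace RatStarPoly

/-- The product of two complex coefficients, in codes. -/
def coeffMul (c d : ℕ × ℕ) : ℕ × ℕ :=
  (RatCode.add (RatCode.mul c.1 d.1) (RatCode.neg (RatCode.mul c.2 d.2)),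
    RatCode.add (RatCode.mul c.1 d.2) (RatCode.mul c.2 d.1))

theorem complexOfCode_coeffMul (c d : ℕ × ℕ) :
    complexOfCode (coeffMul c d) = complexOfCode c * complexOfCode d := by
  simp only [complexOfCode, coeffMul, RatCode.ratOfCode_add, RatCode.ratOfCode_mul,
    RatCode.ratOfCode_neg]
  push_cast
  linear_combination -(ratOfCode c.2 : ℂ) * ratOfCode d.2 * Complex.I_mul_I

/-- The product of a polynomial with a complex number. -/
def smul (c : ℕ × ℕ) (p : RatStarPoly) : RatStarPoly :=
  p.map fun t => (coeffMul c t.1, t.2)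

/-- The concatenation of two words. -/
def wordMul (v w : StarWord) : StarWord := (v.1, v.2 ++ w.1 :: w.2)

/-- The product of two polynomials. -/
def mul (p q : RatStarPoly) : RatStarPoly :=
  p.flatMap fun s => q.map fun t => (coeffMul s.1 t.1, wordMul s.2 t.2)

/-- The difference of two polynomials. -/
def sub (p q : RatStarPoly) : RatStarPoly :=
  p ++ smul (RatCode.neg (RatCode.divSucc 1 0), 0) q

section Eval

variable {A : Type*} [NonUnitalCStarAlgebra A] (u : ℕ → A)

theorem eval_append (p q : RatStarPoly) :
    evalRatStarPoly u (p ++ q) = evalRatStarPoly u p + evalRatStarPoly u q := by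
  simp [evalRatStarPoly]

theorem eval_cons (t : (ℕ × ℕ) × StarWord) (p : RatStarPoly) :
    evalRatStarPoly u (t :: p) = complexOfCode t.1 • evalWord u t.2 + evalRatStarPoly u p := by
  simp [evalRatStarPoly, complexOfCode]

theorem eval_nil : evalRatStarPoly u [] = 0 := by simp [evalRatStarPoly]

theorem eval_smul (c : ℕ × ℕ) (p : RatStarPoly) :
    evalRatStarPoly u (smul c p) = complexOfCode c • evalRatStarPoly u p := by
  induction p with
  | nil => simp [smul, eval_nil]
  | cons t p ih =>
    change evalRatStarPoly u ((coeffMul c t.1, t.2) :: smul c p) = _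
    rw [eval_cons, eval_cons, ih, complexOfCode_coeffMul, smul_add, smul_smul]

theorem evalWord_wordMul (v w : StarWord) :
    evalWord u (wordMul v w) = evalWord u v * evalWord u w := by
  have h : ∀ (l : List StarLetter) (x y : A), l.foldl (fun a s => a * evalLetter u s) (x * y) =
      x * l.foldl (fun a s => a * evalLetter u s) y := by
    intro l
    induction l with
    | nil => simp
    | cons s l ih => intro x y; simp [mul_assoc, ih]
  simp [evalWord, wordMul, List.foldl_append, h]

theorem eval_mul (p q : RatStarPoly) :
    evalRatStarPoly u (mul p q) = evalRatStarPoly u p * evalRatStarPoly u q := by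
  have h : ∀ (s : (ℕ × ℕ) × StarWord) (q : RatStarPoly),
      evalRatStarPoly u (q.map fun t => (coeffMul s.1 t.1, wordMul s.2 t.2)) =
        (complexOfCode s.1 • evalWord u s.2) * evalRatStarPoly u q := by
    intro s q
    induction q with
    | nil => simp [eval_nil]
    | cons t q ih =>
      rw [List.map_cons, eval_cons, eval_cons, ih, complexOfCode_coeffMul, evalWord_wordMul, mul_add,
        smul_mul_smul_comm]
  induction p with
  | nil => simp [mul, eval_nil]
  | cons s p ih =>
    change evalRatStarPoly u (_ ++ mul p q) = _
    rw [eval_append, h, ih, eval_cons, add_mul]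

theorem eval_sub (p q : RatStarPoly) :
    evalRatStarPoly u (sub p q) = evalRatStarPoly u p - evalRatStarPoly u q := by
  have h : complexOfCode (RatCode.neg (RatCode.divSucc 1 0), 0) = -1 := by
    simp [complexOfCode, RatCode.ratOfCode_neg, RatCode.ratOfCode_divSucc, ratOfCode_zero]
  rw [sub, eval_append, eval_smul, h, neg_one_smul, sub_eq_add_neg]

/-- The polynomial consisting of a single letter. -/
def letter (s : StarLetter) : RatStarPoly := [((RatCode.divSucc 1 0, 0), (s, []))]

theorem eval_letter (s : StarLetter) : evalRatStarPoly u (letter s) = evalLetter u s := by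
  have h : complexOfCode (RatCode.divSucc 1 0, 0) = 1 := by
    simp [complexOfCode, RatCode.ratOfCode_divSucc, ratOfCode_zero]
  rw [letter, eval_cons, eval_nil, h, one_smul, add_zero]
  rfl

/-- The closure of the set of rational vectors is closed under sums, products and complex multiples,
by continuity and the density of `ℚ(i)` in `ℂ`. Adjoints need no case of their own, because the
letters already include the adjoints of the generators. -/
theorem dense_range_eval (P : CStarPresentation A) : DenseRange (evalRatStarPoly P.gen) := by
  rw [DenseRange, ← dense_closure]
  refine P.dense.mono fun x hx => ?_
  have hx' : x ∈ NonUnitalAlgebra.adjoin ℂ (Set.range P.gen ∪ star (Set.range P.gen)) := by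
    rw [← NonUnitalStarAlgebra.adjoin_toNonUnitalSubalgebra]
    exact hx
  clear hx
  induction hx' using NonUnitalAlgebra.adjoin_induction with
  | mem x h =>
    refine subset_closure ?_
    rcases h with ⟨m, rfl⟩ | ⟨m, hm⟩
    · exact ⟨letter (m, false), by rw [eval_letter]; simp [evalLetter]⟩
    · exact ⟨letter (m, true), by rw [eval_letter]; simp [evalLetter, hm]⟩
  | add x y hx hy ihx ihy =>
    refine map_mem_closure₂ continuous_add ihx ihy ?_
    · rintro _ ⟨p, rfl⟩ _ ⟨q, rfl⟩
      exact ⟨p ++ q, eval_append _ _ _⟩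
  | zero => exact subset_closure ⟨[], eval_nil _⟩
  | mul x y hx hy ihx ihy =>
    refine map_mem_closure₂ continuous_mul ihx ihy ?_
    · rintro _ ⟨p, rfl⟩ _ ⟨q, rfl⟩
      exact ⟨mul p q, eval_mul _ _ _⟩
  | smul c x hx ihx =>
    refine map_mem_closure₂ continuous_smul (denseRange_complexOfCode c) ihx ?_
    · rintro _ ⟨c, rfl⟩ _ ⟨p, rfl⟩
      exact ⟨smul c p, eval_smul _ _ _⟩

end Eval

section Primrec

open Primrec

theorem primrec_coeffMul : Primrec₂ coeffMul := by
  have h11 := fst.comp (fst (α := ℕ × ℕ) (β := ℕ × ℕ))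
  have h12 := snd.comp (fst (α := ℕ × ℕ) (β := ℕ × ℕ))
  have h21 := fst.comp (snd (α := ℕ × ℕ) (β := ℕ × ℕ))
  have h22 := snd.comp (snd (α := ℕ × ℕ) (β := ℕ × ℕ))
  exact Primrec.pair
    (RatCode.primrec_add.comp (RatCode.primrec_mul.comp h11 h21)
      (RatCode.primrec_neg.comp (RatCode.primrec_mul.comp h12 h22)))
    (RatCode.primrec_add.comp (RatCode.primrec_mul.comp h11 h22)
      (RatCode.primrec_mul.comp h12 h21))

theorem primrec_smul : Primrec₂ smul :=
  list_map snd (Primrec.pair (primrec_coeffMul.comp (fst.comp fst) (fst.comp snd)) (snd.comp snd))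

theorem primrec_wordMul : Primrec₂ wordMul :=
  Primrec.pair (fst.comp fst) (list_append.comp (snd.comp fst)
    (list_cons.comp (fst.comp snd) (snd.comp snd)))

theorem primrec_mul : Primrec₂ mul := by
  refine list_flatMap fst (list_map (snd.comp fst) (Primrec.pair ?_ ?_))
  · exact primrec_coeffMul.comp (fst.comp (snd.comp fst)) (fst.comp snd)
  · exact primrec_wordMul.comp (snd.comp (snd.comp fst)) (snd.comp snd)

theorem primrec_sub : Primrec₂ sub :=
  list_append.comp fst (primrec_smul.comp (.const _) snd)

theorem primrec_letter : Primrec letter :=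
  list_cons.comp (Primrec.pair (.const _) (Primrec.pair .id (.const []))) (.const [])

theorem primrec_ratStarPoly : Primrec ratStarPoly :=
  option_getD.comp Primrec.decode (.const [])

end Primrec

theorem ratStarPoly_encode (p : RatStarPoly) : ratStarPoly (Encodable.encode p) = p := by
  simp [ratStarPoly]

end RatStarPoly

universe u

open WeakDual

/-! ## Named presentations and the computability of the norm -/

/-- A commutative unital C⋆-algebra whose spectrum has finitely many components, with a presentation
and a name of it. -/
structure NamedAlgebra where
  carrier : Type u
  [alg : CommCStarAlgebra carrier]
  pres : CStarPresentation carrier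
  name : ℕ → ℕ
  isName : pres.IsName name
  finite : Finite (ConnectedComponents (characterSpace ℂ carrier))

namespace NamedAlgebra

attribute [instance] NamedAlgebra.alg NamedAlgebra.finite

/-- The spectrum of the algebra. -/
abbrev Spectrum (i : NamedAlgebra.{u}) : Type u := characterSpace ℂ i.carrier

/-- The number of connected components of the spectrum. -/
noncomputable def numComponents (i : NamedAlgebra.{u}) : ℕ :=
  Nat.card (ConnectedComponents i.Spectrum)

/-- The value of a rational ⋆-polynomial at the generators of the presentation. -/
noncomputable def eval (i : NamedAlgebra.{u}) (p : RatStarPoly) : i.carrier :=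
  evalRatStarPoly i.pres.gen p

/-- Uniform computability from the name and the number of components. -/
abbrev IsComputable {α β : Type*} [Primcodable α] [Primcodable β]
    (Φ : NamedAlgebra.{u} → α → β) : Prop :=
  UniformComputable name numComponents Φ

/-- Uniform computability of a rational-valued function. -/
abbrev IsComputableRat {α : Type*} [Primcodable α] (q : NamedAlgebra.{u} → α → ℚ) : Prop :=
  UniformComputableRat name numComponents q

variable (i : NamedAlgebra.{u})

theorem eval_append (p q : RatStarPoly) : i.eval (p ++ q) = i.eval p + i.eval q :=
  RatStarPoly.eval_append _ p q

theorem eval_mul (p q : RatStarPoly) : i.eval (.mul p q) = i.eval p * i.eval q :=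
  RatStarPoly.eval_mul _ p q

theorem eval_sub (p q : RatStarPoly) : i.eval (.sub p q) = i.eval p - i.eval q :=
  RatStarPoly.eval_sub _ p q

theorem eval_smul (c : ℕ × ℕ) (p : RatStarPoly) :
    i.eval (.smul c p) = complexOfCode c • i.eval p :=
  RatStarPoly.eval_smul _ c p

theorem denseRange_eval : DenseRange i.eval := RatStarPoly.dense_range_eval i.pres

theorem exists_name_iff (r r' : ℚ) (p : RatStarPoly) :
    (∃ k, tripleOfCode (i.name k) = (r, Encodable.encode p, r')) ↔
      0 < r ∧ 0 < r' ∧ (r : ℝ) < ‖i.eval p‖ ∧ ‖i.eval p‖ < r' := by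
  have h : (r, Encodable.encode p, r') ∈ i.pres.diagram ↔
      (r, Encodable.encode p, r') ∈ Set.range fun k => tripleOfCode (i.name k) := by
    rw [i.isName]
  rw [Set.mem_range] at h
  rw [← h, CStarPresentation.diagram, Set.mem_ofPred_eq, CStarPresentation.ratVector,
    RatStarPoly.ratStarPoly_encode]
  rfl

/-- The polynomial with nonzero value that the first item of the name refers to. -/
def nonzeroPoly : RatStarPoly := ratStarPoly (i.name 0).unpair.2.unpair.1

/-- A name is a total function, so its first item lies in the diagram, where the lower bound of the
norm is positive. In particular the zero algebra has no name. -/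
theorem eval_nonzeroPoly_ne_zero : i.eval i.nonzeroPoly ≠ 0 := by
  have h : tripleOfCode (i.name 0) ∈ i.pres.diagram := by rw [i.isName]; exact ⟨0, rfl⟩
  have h0 : (0 : ℝ) < (tripleOfCode (i.name 0)).1 := Rat.cast_pos.2 h.1
  exact norm_pos_iff.1 (h0.trans h.2.2.1)

instance : Nontrivial i.carrier := ⟨_, _, i.eval_nonzeroPoly_ne_zero⟩

instance : Nonempty i.Spectrum := inferInstance

/-- A sequence of small nonzero vectors. -/
def smallPoly (t : ℕ) : RatStarPoly := .smul (RatCode.divSucc 1 t, 0) i.nonzeroPoly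

theorem eval_smallPoly (t : ℕ) :
    i.eval (i.smallPoly t) = (1 / ((t : ℂ) + 1)) • i.eval i.nonzeroPoly := by
  simp [smallPoly, eval_smul, complexOfCode, RatCode.ratOfCode_divSucc, ratOfCode_zero]

theorem eval_smallPoly_ne_zero (t : ℕ) : i.eval (i.smallPoly t) ≠ 0 := by
  rw [eval_smallPoly]
  exact smul_ne_zero (one_div_ne_zero (Nat.cast_add_one_ne_zero t)) i.eval_nonzeroPoly_ne_zero

/-- A vector that vanishes occurs in no triple of the diagram, so waiting for bounds on `‖i.eval p‖`
might never end. A small nonzero perturbation makes the vector nonzero; taking it smaller than a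
nonzero `‖i.eval p‖` prevents cancellation. -/
theorem exists_smallPoly (p : RatStarPoly) {ε : ℝ} (hε : 0 < ε) :
    ∃ t, ‖i.eval (i.smallPoly t)‖ < ε ∧ i.eval (p ++ i.smallPoly t) ≠ 0 := by
  have hlim : Filter.Tendsto (fun t : ℕ => ‖i.eval (i.smallPoly t)‖) Filter.atTop (nhds 0) := by
    have h := (tendsto_one_div_add_atTop_nhds_zero_nat (𝕜 := ℂ)).smul_const
      (i.eval i.nonzeroPoly)
    simpa only [eval_smallPoly, zero_smul, norm_zero] using h.norm
  have key : ∀ δ : ℝ, 0 < δ → ∃ t, ‖i.eval (i.smallPoly t)‖ < δ := fun δ hδ =>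
    ((hlim.eventually (gt_mem_nhds hδ)).exists)
  by_cases hp : i.eval p = 0
  · obtain ⟨t, ht⟩ := key ε hε
    exact ⟨t, ht, by rw [eval_append, hp, zero_add]; exact i.eval_smallPoly_ne_zero t⟩
  · obtain ⟨t, ht⟩ := key (min ε ‖i.eval p‖) (lt_min hε (norm_pos_iff.2 hp))
    refine ⟨t, ht.trans_le (min_le_left _ _), fun h => ?_⟩
    rw [eval_append, add_eq_zero_iff_eq_neg] at h
    have := ht.trans_le (min_le_right _ _)
    rw [h, norm_neg] at this
    exact this.false

theorem isComputable_smallPoly : IsComputable fun (i : NamedAlgebra.{u}) t => i.smallPoly t := by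
  have h : IsComputable fun (i : NamedAlgebra.{u}) (_ : ℕ) => i.nonzeroPoly :=
    UniformComputable.map (Φ := fun (i : NamedAlgebra.{u}) (_ : ℕ) => (i.name 0).unpair.2.unpair.1)
      RatStarPoly.primrec_ratStarPoly.to_comp (.unpairFst (.unpairSnd (.oracle (.const 0))))
  have h' : Primrec fun t => (RatCode.divSucc 1 t, 0) :=
    Primrec.pair (RatCode.primrec_divSucc.comp (.const 1) .id) (.const 0)
  exact UniformComputable.map₂ (f := RatStarPoly.smul) RatStarPoly.primrec_smul.to_comp
    (.of_computable h'.to_comp) h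

/-- The norm of rational vectors is uniformly computable. -/
theorem exists_norm_approx :
    ∃ q : NamedAlgebra.{u} → RatStarPoly × ℕ → ℚ, IsComputableRat q ∧
      ∀ i p m, |(q i (p, m) : ℝ) - ‖i.eval p‖| < 1 / ((m : ℝ) + 1) := by
  let A : NamedAlgebra.{u} → (RatStarPoly × ℕ) × ℕ → ℕ := fun i a => i.name a.2.unpair.1
  let B : NamedAlgebra.{u} → (RatStarPoly × ℕ) × ℕ → ℕ :=
    fun i a => i.name a.2.unpair.2.unpair.1
  let W : NamedAlgebra.{u} → (RatStarPoly × ℕ) × ℕ → RatStarPoly :=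
    fun i a => i.smallPoly a.2.unpair.2.unpair.2
  have hA : IsComputable A := .oracle (.unpairFst UniformComputable.id.snd)
  have hB : IsComputable B := .oracle (.unpairFst (.unpairSnd UniformComputable.id.snd))
  have hW : IsComputable W :=
    isComputable_smallPoly.comp (.unpairSnd (.unpairSnd UniformComputable.id.snd))
  -- A candidate codes two items of the name and an index of a small vector `w`. The items must give
  -- bounds `r < ‖p + w‖ < s` and `‖w‖ < s2` with `s - r + s2 < 1 / (m + 1)`; then `r` is within `1
  -- / (m + 1)` of the norm of `p`.
  let T : NamedAlgebra.{u} → (RatStarPoly × ℕ) × ℕ → Bool := fun i a =>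
    (decide ((A i a).unpair.2.unpair.1 = Encodable.encode (a.1.1 ++ W i a)) &&
      decide ((B i a).unpair.2.unpair.1 = Encodable.encode (W i a))) &&
    decide (ratOfCode (A i a).unpair.2.unpair.2 - ratOfCode (A i a).unpair.1 +
      ratOfCode (B i a).unpair.2.unpair.2 < ((1 : ℕ) : ℚ) / ((a.1.2 : ℚ) + 1))
  have hT : IsComputable T := by
    refine .and (.and ?_ ?_) ?_
    · exact .natEq (.unpairFst (.unpairSnd hA)) (.map Primrec.encode.to_comp
        (.map₂ Primrec.list_append.to_comp UniformComputable.id.fst.fst hW))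
    · exact .natEq (.unpairFst (.unpairSnd hB)) (.map Primrec.encode.to_comp hW)
    · exact UniformComputableRat.lt (.add (.sub (.ofCode (.unpairSnd (.unpairSnd hA)))
        (.ofCode (.unpairFst hA))) (.ofCode (.unpairSnd (.unpairSnd hB))))
        (.divSucc (.const 1) UniformComputable.id.fst.snd)
  have hex : ∀ i a, ∃ k, T i (a, k) = true := by
    rintro i ⟨p, m⟩
    set ε : ℝ := 1 / ((m : ℝ) + 1) with hεd
    have hε : 0 < ε := by positivity
    obtain ⟨t, ht, hne⟩ := i.exists_smallPoly p (show 0 < ε / 4 by positivity)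
    obtain ⟨r, hr, hr'⟩ := exists_rat_btwn
      (show max 0 (‖i.eval (p ++ i.smallPoly t)‖ - ε / 4) < ‖i.eval (p ++ i.smallPoly t)‖ from
        max_lt (norm_pos_iff.2 hne) (by linarith))
    obtain ⟨s, hs, hs'⟩ := exists_rat_btwn
      (show ‖i.eval (p ++ i.smallPoly t)‖ < ‖i.eval (p ++ i.smallPoly t)‖ + ε / 4 by linarith)
    obtain ⟨r2, hr2, hr2'⟩ := exists_rat_btwn (norm_pos_iff.2 (i.eval_smallPoly_ne_zero t))
    obtain ⟨s2, hs2, hs2'⟩ := exists_rat_btwn ht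
    have hr0 := (le_max_left _ _).trans_lt hr
    have hr1 := (le_max_right _ _).trans_lt hr
    obtain ⟨k1, hk1⟩ := (i.exists_name_iff r s _).2
      ⟨Rat.cast_pos.1 hr0, Rat.cast_pos.1 ((hr0.trans hr').trans hs), hr', hs⟩
    obtain ⟨k2, hk2⟩ := (i.exists_name_iff r2 s2 _).2
      ⟨Rat.cast_pos.1 hr2, Rat.cast_pos.1 ((hr2.trans hr2').trans hs2), hr2', hs2⟩
    simp only [tripleOfCode, Prod.mk.injEq] at hk1 hk2
    refine ⟨Nat.pair k1 (Nat.pair k2 t), ?_⟩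
    simp only [T, A, B, W, Nat.unpair_pair, hk1, hk2, decide_true, Bool.true_and,
      decide_eq_true_eq]
    rw [← Rat.cast_lt (K := ℝ)]
    push_cast
    linarith
  obtain ⟨Φ, hΦ, hΦT⟩ := UniformComputable.exists_choice hT hex
  refine ⟨fun i a => ratOfCode (A i (a, Φ i a)).unpair.1,
    .ofCode (.unpairFst (hA.comp (.pair .id hΦ))), fun i p m => ?_⟩
  have h := hΦT i (p, m)
  simp only [T, Bool.and_eq_true, decide_eq_true_eq] at h
  obtain ⟨⟨h1, h2⟩, h3⟩ := h
  have e1 := (i.exists_name_iff _ _ (p ++ W i ((p, m), Φ i (p, m)))).1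
    ⟨_, by rw [tripleOfCode, h1]⟩
  have e2 := (i.exists_name_iff _ _ (W i ((p, m), Φ i (p, m)))).1 ⟨_, by rw [tripleOfCode, h2]⟩
  rw [← Rat.cast_lt (K := ℝ)] at h3
  push_cast at h3
  have h4 := norm_add_le (i.eval p) (i.eval (W i ((p, m), Φ i (p, m))))
  have h5 := norm_sub_le (i.eval (p ++ W i ((p, m), Φ i (p, m))))
    (i.eval (W i ((p, m), Φ i (p, m))))
  rw [eval_append, add_sub_cancel_right, ← eval_append] at h5
  rw [← eval_append] at h4
  rw [abs_lt]
  constructor <;> linarith [e1.2.2.1, e1.2.2.2, e2.2.2.1, e2.2.2.2]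

end NamedAlgebra

/-! ## Computing the unit -/

/-- The `l`-th entry of the finite sequence of natural numbers with code `c`. -/
def codedSeq (c l : ℕ) : ℕ := ((Encodable.decode (α := List ℕ) c).getD []).getD l 0

theorem primrec_codedSeq : Primrec₂ codedSeq :=
  (Primrec.list_getD 0).comp
    (Primrec.option_getD.comp (Primrec.decode.comp Primrec.fst) (.const [])) Primrec.snd

theorem codedSeq_encode (s : List ℕ) (l : ℕ) : codedSeq (Encodable.encode s) l = s.getD l 0 := by
  simp [codedSeq]

theorem exists_codedSeq_eq (v : ℕ → ℕ) (m : ℕ) : ∃ c, ∀ l < m, codedSeq c l = v l :=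
  ⟨Encodable.encode ((List.range m).map v), fun l hl => by
    rw [codedSeq_encode, List.getD_eq_getElem _ _ (by simpa using hl)]; simp⟩

/-- A clopen set contains the component of each of its points, hence is determined by its image
among the components. -/
theorem IsClopen.preimage_image_connectedComponents {X : Type*} [TopologicalSpace X] {S : Set X}
    (hS : IsClopen S) : ConnectedComponents.mk ⁻¹' (ConnectedComponents.mk '' S) = S := by
  refine Set.Subset.antisymm ?_ (Set.subset_preimage_image _ _)
  rintro x ⟨y, hy, hxy⟩
  exact hS.connectedComponent_subset hy (ConnectedComponents.coe_eq_coe'.1 hxy.symm)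

/-- A strictly increasing chain of clopen sets that has as many steps as the space has connected
components ends with the whole space. -/
theorem eq_univ_of_isClopen_chain {X : Type*} [TopologicalSpace X]
    [Finite (ConnectedComponents X)] {S : ℕ → Set X}
    (hS : ∀ l ≤ Nat.card (ConnectedComponents X), IsClopen (S l))
    (hlt : ∀ l < Nat.card (ConnectedComponents X), S l ⊂ S (l + 1)) :
    S (Nat.card (ConnectedComponents X)) = Set.univ := by
  have key : ∀ l ≤ Nat.card (ConnectedComponents X),
      l ≤ (ConnectedComponents.mk '' S l).ncard := by
    intro l hl
    induction l with
    | zero => exact Nat.zero_le _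
    | succ l ih =>
      refine (ih (by omega)).trans_lt (Set.ncard_lt_ncard ?_ (Set.toFinite _))
      refine (Set.image_mono (hlt l hl).subset).ssubset_of_ne fun h => (hlt l hl).ne ?_
      rw [← (hS l (by omega)).preimage_image_connectedComponents, h,
        (hS (l + 1) hl).preimage_image_connectedComponents]
  have h := Set.eq_of_subset_of_ncard_le (Set.subset_univ _)
    ((Set.ncard_univ _).trans_le (key _ le_rfl)) (Set.toFinite _)
  rw [← (hS _ le_rfl).preimage_image_connectedComponents, h, Set.preimage_univ]

/-! ### Gelfand theory: approximate projections and clopen subsets of the spectrum -/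

section Gelfand

variable {A : Type*} [CommCStarAlgebra A]

theorem norm_character_apply_le (φ : characterSpace ℂ A) (a : A) : ‖φ a‖ ≤ ‖a‖ := by
  rw [← (AddMonoidHomClass.isometry_iff_norm _).1 (gelfandTransform_isometry A) a]
  exact ContinuousMap.norm_coe_le_norm (gelfandTransform ℂ A a) φ

theorem norm_le_of_character_apply {a : A} {C : ℝ} (hC : 0 ≤ C)
    (h : ∀ φ : characterSpace ℂ A, ‖φ a‖ ≤ C) : ‖a‖ ≤ C := by
  rw [← (AddMonoidHomClass.isometry_iff_norm _).1 (gelfandTransform_isometry A) a]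
  exact (ContinuousMap.norm_le _ hC).2 h

theorem exists_lt_norm_character_apply {a : A} {C : ℝ} (hC : 0 ≤ C) (h : C < ‖a‖) :
    ∃ φ : characterSpace ℂ A, C < ‖φ a‖ := by
  by_contra! hn
  exact h.not_ge (norm_le_of_character_apply hC hn)

theorem continuous_character_apply (a : A) : Continuous fun φ : characterSpace ℂ A => φ a :=
  (gelfandTransform ℂ A a).continuous

/-- The product `‖z‖ * ‖z - 1‖` is less than `δ`, and one of the two factors is at least `1 / 2`. -/
theorem norm_lt_or_norm_sub_one_lt {z : ℂ} {δ : ℝ} (hz : ‖z * z - z‖ < δ) :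
    ‖z‖ < 2 * δ ∨ ‖z - 1‖ < 2 * δ := by
  have h1 : z * z - z = z * (z - 1) := by ring
  rw [h1, norm_mul] at hz
  have h2 : 1 ≤ ‖z‖ + ‖z - 1‖ := by
    have := norm_sub_le z (z - 1)
    simpa using this
  by_contra! hn
  rcases le_total ‖z‖ (1 / 2) with h | h <;> nlinarith [norm_nonneg z, norm_nonneg (z - 1)]

/-- The last member of a chain of approximate projections that has as many steps as the spectrum has
connected components is close to the unit. -/
theorem norm_sub_one_le_of_chain [Finite (ConnectedComponents (characterSpace ℂ A))]
    {n : ℕ} (hn : Nat.card (ConnectedComponents (characterSpace ℂ A)) = n) (hn0 : 0 < n)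
    {δ : ℝ} (hδ : δ ≤ 1 / 16) {q : ℕ → A}
    (h1 : ∀ l < n, ‖q l * q l - q l‖ < δ) (h2 : ∀ l < n, ‖q (l + 1) * q (l + 1) - q (l + 1)‖ < δ)
    (h3 : ∀ l < n, ‖q (l + 1) * q l - q l‖ < δ) (h4 : ∀ l < n, 1 / 2 < ‖q (l + 1) - q l‖) :
    ‖q n - 1‖ ≤ 2 * δ := by
  have hidem : ∀ l ≤ n, ∀ φ : characterSpace ℂ A, ‖φ (q l)‖ < 2 * δ ∨ ‖φ (q l) - 1‖ < 2 * δ := by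
    intro l hl φ
    apply norm_lt_or_norm_sub_one_lt
    have h := norm_character_apply_le φ (q l * q l - q l)
    rw [map_sub, map_mul] at h
    refine h.trans_lt ?_
    rcases hl.lt_or_eq with hl | rfl
    · exact h1 l hl
    · obtain ⟨m, rfl⟩ := Nat.exists_eq_succ_of_ne_zero hn0.ne'
      exact h2 m (Nat.lt_succ_self m)
  have htri : ∀ z : ℂ, 1 ≤ ‖z‖ + ‖z - 1‖ := fun z => by
    simpa using norm_sub_le z (z - 1)
  let S : ℕ → Set (characterSpace ℂ A) := fun l => {φ | ‖φ (q l) - 1‖ < 1 / 2}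
  have hclopen : ∀ l ≤ n, IsClopen (S l) := by
    intro l hl
    refine ⟨⟨?_⟩, isOpen_lt ((continuous_character_apply _).sub continuous_const).norm
      continuous_const⟩
    -- Values of `q l` lie within `2 * δ ≤ 1 / 8` of `0` or of `1`, so the complement is also given
    -- by an open condition.
    have : (S l)ᶜ = {φ | ‖φ (q l)‖ < 1 / 2} := by
      ext φ
      simp only [S, Set.mem_compl_iff, Set.mem_ofPred_eq, not_lt]
      have := htri (φ (q l))
      rcases hidem l hl φ with h | h <;> constructor <;> intro h' <;> linarith
    rw [this]
    exact isOpen_lt (continuous_character_apply _).norm continuous_const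
  have hchain : ∀ l < n, S l ⊂ S (l + 1) := by
    intro l hl
    have hsub : S l ⊆ S (l + 1) := by
      intro φ hφ
      simp only [S, Set.mem_ofPred_eq] at hφ ⊢
      have h := (norm_character_apply_le φ _).trans_lt (h3 l hl)
      have e : φ (q (l + 1) * q l - q l) = (φ (q (l + 1)) - 1) * φ (q l) := by
        rw [map_sub, map_mul]; ring
      rw [e, norm_mul] at h
      have := htri (φ (q l))
      -- Otherwise both factors are at least `1 / 2`, and their product is at least `1 / 4 > δ`.
      by_contra! hn
      nlinarith [norm_nonneg (φ (q l))]
    -- If the two sets were equal, the values of `q l` and `q (l + 1)` at each character would be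
    -- near the same one of `0` and `1`. They would differ by less than `4 * δ ≤ 1 / 4`, against
    -- `h4`.
    refine hsub.ssubset_of_ne fun he => ?_
    obtain ⟨φ, hφ⟩ := exists_lt_norm_character_apply (by norm_num) (h4 l hl)
    rw [map_sub] at hφ
    have hiff : ‖φ (q l) - 1‖ < 1 / 2 ↔ ‖φ (q (l + 1)) - 1‖ < 1 / 2 := Set.ext_iff.1 he φ
    have t1 := htri (φ (q l))
    have t2 := htri (φ (q (l + 1)))
    have t3 := norm_sub_le (φ (q (l + 1))) (φ (q l))
    have t4 := norm_sub_le (φ (q (l + 1)) - 1) (φ (q l) - 1)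
    rw [sub_sub_sub_cancel_right] at t4
    rcases hidem l hl.le φ with ha | ha <;> rcases hidem (l + 1) hl φ with hb | hb
    · linarith
    · have := hiff.2 (by linarith); linarith
    · have := hiff.1 (by linarith); linarith
    · linarith
  subst hn
  have huniv := eq_univ_of_isClopen_chain hclopen hchain
  have hδ0 : 0 < δ := (norm_nonneg _).trans_lt (h1 0 hn0)
  refine norm_le_of_character_apply (by positivity) fun φ => ?_
  have hφ : φ ∈ S _ := huniv ▸ Set.mem_univ φ
  simp only [S, Set.mem_ofPred_eq] at hφ
  rw [map_sub, map_one]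
  rcases hidem _ le_rfl φ with h | h
  · have := htri (φ (q (Nat.card (ConnectedComponents (characterSpace ℂ A)))))
    linarith
  · exact h.le

/-- The projections onto unions of increasingly many connected components of the spectrum. -/
theorem exists_projection_chain [Finite (ConnectedComponents (characterSpace ℂ A))] :
    ∃ b : ℕ → A, (∀ l, b l * b l = b l) ∧ (∀ l, b (l + 1) * b l = b l) ∧ (∀ l, ‖b l‖ ≤ 1) ∧
      ∀ l < Nat.card (ConnectedComponents (characterSpace ℂ A)), 1 ≤ ‖b (l + 1) - b l‖ := by
  classical
  let e := Finite.equivFin (ConnectedComponents (characterSpace ℂ A))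
  -- The finite space of components is discrete, so the indicator of the first `l` components is
  -- continuous; Gelfand duality turns it into an element of `A`.
  let χ : ℕ → C(characterSpace ℂ A, ℂ) := fun l =>
    ⟨fun φ => if (e (ConnectedComponents.mk φ) : ℕ) < l then 1 else 0,
      (continuous_of_discreteTopology
        (f := fun c : ConnectedComponents (characterSpace ℂ A) =>
          if (e c : ℕ) < l then (1 : ℂ) else 0)).comp ConnectedComponents.continuous_coe⟩
  obtain ⟨b, hb⟩ : ∃ b : ℕ → A, ∀ l, gelfandTransform ℂ A (b l) = χ l :=
    ⟨fun l => (gelfandTransform_bijective A).surjective (χ l) |>.choose,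
      fun l => ((gelfandTransform_bijective A).surjective (χ l)).choose_spec⟩
  have hbφ : ∀ l (φ : characterSpace ℂ A),
      φ (b l) = if (e (ConnectedComponents.mk φ) : ℕ) < l then 1 else 0 := fun l φ =>
    DFunLike.congr_fun (hb l) φ
  have hext : ∀ a c : A, (∀ φ : characterSpace ℂ A, φ a = φ c) → a = c := fun a c h =>
    (gelfandTransform_bijective A).injective (ContinuousMap.ext h)
  refine ⟨b, fun l => hext _ _ fun φ => ?_, fun l => hext _ _ fun φ => ?_,
    fun l => norm_le_of_character_apply zero_le_one fun φ => ?_, fun l hl => ?_⟩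
  · rw [map_mul, hbφ]; split_ifs <;> simp
  · rw [map_mul, hbφ, hbφ]; split_ifs <;> first | omega | simp
  · rw [hbφ]; split_ifs <;> simp
  · obtain ⟨φ, hφ⟩ := ConnectedComponents.surjective_coe (e.symm ⟨l, hl⟩)
    have h := norm_character_apply_le φ (b (l + 1) - b l)
    rw [map_sub, hbφ, hbφ, hφ] at h
    simpa using h

end Gelfand

/-- Ensures that rational approximations of a genuine chain of projections pass the test in the
search for the unit. -/
theorem norm_mul_sub_le {A : Type*} [NormedRing A] {a b x y : A} {η : ℝ} (hη : η ≤ 1)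
    (hab : b * a = a) (ha : ‖a‖ ≤ 1) (hb : ‖b‖ ≤ 1) (hx : ‖x - a‖ ≤ η) (hy : ‖y - b‖ ≤ η) :
    ‖y * x - x‖ ≤ 4 * η := by
  have e : y * x - x = (y - b) * (x - a) + (y - b) * a + b * (x - a) - (x - a) := by
    rw [← sub_eq_zero]
    have : y * x - x - ((y - b) * (x - a) + (y - b) * a + b * (x - a) - (x - a)) = b * a - a := by
      noncomm_ring
    rw [this, hab, sub_self]
  have h0 : 0 ≤ η := (norm_nonneg _).trans hx
  rw [e]
  refine (norm_sub_le _ _).trans ?_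
  have h1 : ‖(y - b) * (x - a)‖ ≤ η * 1 :=
    (norm_mul_le _ _).trans (mul_le_mul hy (hx.trans hη) (norm_nonneg _) h0)
  have h2 : ‖(y - b) * a‖ ≤ η * 1 :=
    (norm_mul_le _ _).trans (mul_le_mul hy ha (norm_nonneg _) h0)
  have h3 : ‖b * (x - a)‖ ≤ 1 * η :=
    (norm_mul_le _ _).trans (mul_le_mul hb hx (norm_nonneg _) zero_le_one)
  have h4 := norm_add₃_le (a := (y - b) * (x - a)) (b := (y - b) * a) (c := b * (x - a))
  linarith

namespace NamedAlgebra

theorem numComponents_pos (i : NamedAlgebra.{u}) : 0 < i.numComponents := by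
  have : Nonempty (ConnectedComponents i.Spectrum) :=
    ConnectedComponents.nonempty_iff_nonempty.2 inferInstance
  exact Nat.card_pos

/-- The unit is uniformly computable. -/
theorem exists_unit_approx :
    ∃ e : NamedAlgebra.{u} → ℕ → RatStarPoly, IsComputable e ∧
      ∀ (i : NamedAlgebra.{u}) (k : ℕ), ‖i.eval (e i k) - 1‖ ≤ 1 / ((k : ℝ) + 1) := by
  obtain ⟨N, hN, hNspec⟩ := exists_norm_approx.{u}
  let Q : NamedAlgebra.{u} → (ℕ × ℕ) × ℕ → RatStarPoly :=
    fun _ a => ratStarPoly (codedSeq a.1.2 a.2)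
  let Q' : NamedAlgebra.{u} → (ℕ × ℕ) × ℕ → RatStarPoly :=
    fun _ a => ratStarPoly (codedSeq a.1.2 (a.2 + 1))
  -- Norms are computed with error `δ = 1 / (48 * (k + 1))`. The test at `2 * δ` accepts every true
  -- defect up to `δ` and guarantees a defect below `3 * δ = 1 / (16 * (k + 1))`, as
  -- `norm_sub_one_le_of_chain` requires.
  let M : NamedAlgebra.{u} → (ℕ × ℕ) × ℕ → ℕ := fun _ a => 48 * a.1.1 + 47
  have hQ : IsComputable Q := .map RatStarPoly.primrec_ratStarPoly.to_comp
    (.map₂ primrec_codedSeq.to_comp UniformComputable.id.fst.snd UniformComputable.id.snd)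
  have hQ' : IsComputable Q' := .map RatStarPoly.primrec_ratStarPoly.to_comp
    (.map₂ primrec_codedSeq.to_comp UniformComputable.id.fst.snd
      (UniformComputable.id.snd.map Primrec.succ.to_comp))
  have hM : IsComputable M := UniformComputable.id.fst.fst.map (f := fun k => 48 * k + 47)
    (Primrec.nat_add.comp (Primrec.nat_mul.comp (.const 48) .id) (.const 47)).to_comp
  let D : NamedAlgebra.{u} → (ℕ × ℕ) × ℕ → RatStarPoly → RatStarPoly → Bool := fun i a p r =>
    decide (N i (.sub (.mul p r) r, M i a) < ((2 : ℕ) : ℚ) / ((M i a : ℚ) + 1))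
  have hD : ∀ p r : NamedAlgebra.{u} → (ℕ × ℕ) × ℕ → RatStarPoly, IsComputable p →
      IsComputable r → IsComputable fun i a => D i a (p i a) (r i a) := fun p r hp hr =>
    UniformComputableRat.lt (hN.comp (.pair (.map₂ RatStarPoly.primrec_sub.to_comp
      (.map₂ RatStarPoly.primrec_mul.to_comp hp hr) hr) hM)) (.divSucc (.const 2) hM)
  let T : NamedAlgebra.{u} → (ℕ × ℕ) × ℕ → Bool := fun i a =>
    ((D i a (Q i a) (Q i a) && D i a (Q' i a) (Q' i a)) && D i a (Q' i a) (Q i a)) &&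
      decide (1 / 2 + ((1 : ℕ) : ℚ) / ((M i a : ℚ) + 1) < N i (.sub (Q' i a) (Q i a), M i a))
  have hT : IsComputable T := by
    refine .and (.and (.and (hD _ _ hQ hQ) (hD _ _ hQ' hQ')) (hD _ _ hQ' hQ)) ?_
    exact UniformComputableRat.lt (.add (.const _) (.divSucc (.const 1) hM))
      (hN.comp (.pair (.map₂ RatStarPoly.primrec_sub.to_comp hQ' hQ) hM))
  have hex : ∀ (i : NamedAlgebra.{u}) (k : ℕ), ∃ L,
      decide (∀ l < i.numComponents, T i ((k, L), l) = true) = true := by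
    intro i k
    obtain ⟨b, hb1, hb2, hb3, hb4⟩ := exists_projection_chain (A := i.carrier)
    set δ : ℝ := 1 / (((48 * k + 47 : ℕ) : ℝ) + 1) with hδd
    have hδ : 0 < δ := by positivity
    have hδ' : δ ≤ 1 / 48 := by
      rw [hδd]; push_cast
      exact one_div_le_one_div_of_le (by norm_num) (by linarith [k.cast_nonneg (α := ℝ)])
    have hq : ∀ l, ∃ p, ‖i.eval p - b l‖ < δ / 4 := fun l => by
      obtain ⟨p, hp⟩ := i.denseRange_eval.exists_dist_lt (b l) (show 0 < δ / 4 by positivity)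
      exact ⟨p, by rwa [← dist_eq_norm, dist_comm]⟩
    choose p hp using hq
    obtain ⟨L, hL⟩ := exists_codedSeq_eq (fun l => Encodable.encode (p l)) (i.numComponents + 1)
    refine ⟨L, ?_⟩
    rw [decide_eq_true_eq]
    intro l hl
    have e1 : Q i ((k, L), l) = p l := by
      simp only [Q, hL l (by omega), RatStarPoly.ratStarPoly_encode]
    have e2 : Q' i ((k, L), l) = p (l + 1) := by
      simp only [Q', hL (l + 1) (by omega), RatStarPoly.ratStarPoly_encode]
    have hDt : ∀ m m', b m' * b m = b m → D i ((k, L), l) (p m') (p m) = true := by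
      intro m m' hm
      have h := norm_mul_sub_le (by linarith) hm (hb3 m) (hb3 m') (hp m).le (hp m').le
      have h' := (abs_lt.1 (hNspec i (.sub (.mul (p m') (p m)) (p m)) (48 * k + 47))).2
      rw [eval_sub, eval_mul, ← hδd] at h'
      simp only [D, M, decide_eq_true_eq]
      rw [← Rat.cast_lt (K := ℝ)]
      have : (((((2 : ℕ) : ℚ) / (((48 * k + 47 : ℕ) : ℚ) + 1) : ℚ)) : ℝ) = 2 * δ := by
        rw [hδd]; push_cast; ring
      rw [this]
      linarith
    simp only [T, e1, e2, hDt _ _ (hb1 l), hDt _ _ (hb1 (l + 1)), hDt _ _ (hb2 l), Bool.true_and,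
      decide_eq_true_eq]
    have h' := (abs_lt.1 (hNspec i (.sub (p (l + 1)) (p l)) (48 * k + 47))).1
    rw [eval_sub, ← hδd] at h'
    have e3 : b (l + 1) - b l = (i.eval (p (l + 1)) - i.eval (p l)) -
      (i.eval (p (l + 1)) - b (l + 1)) + (i.eval (p l) - b l) := by abel
    have h5 := hb4 l hl
    rw [e3] at h5
    have h6 := norm_add_le ((i.eval (p (l + 1)) - i.eval (p l)) -
      (i.eval (p (l + 1)) - b (l + 1))) (i.eval (p l) - b l)
    have h7 := norm_sub_le (i.eval (p (l + 1)) - i.eval (p l)) (i.eval (p (l + 1)) - b (l + 1))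
    have h8 := hp l
    have h9 := hp (l + 1)
    rw [← Rat.cast_lt (K := ℝ)]
    have : (((1 / 2 + ((1 : ℕ) : ℚ) / (((48 * k + 47 : ℕ) : ℚ) + 1) : ℚ)) : ℝ) = 1 / 2 + δ := by
      rw [hδd]; push_cast; ring
    simp only [M]
    rw [this]
    linarith
  obtain ⟨L, hL, hLspec⟩ := UniformComputable.exists_choice (hT.forall_lt .param) hex
  refine ⟨fun i k => ratStarPoly (codedSeq (L i k) i.numComponents),
    .map RatStarPoly.primrec_ratStarPoly.to_comp
      (.map₂ primrec_codedSeq.to_comp hL .param), fun i k => ?_⟩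
  have h := hLspec i k
  rw [decide_eq_true_eq] at h
  set δ : ℝ := 1 / (((48 * k + 47 : ℕ) : ℝ) + 1) with hδd
  have hDs : ∀ l p r, D i ((k, L i k), l) p r = true →
      ‖i.eval p * i.eval r - i.eval r‖ < 3 * δ := by
    intro l p r hd
    simp only [D, M, decide_eq_true_eq] at hd
    rw [← Rat.cast_lt (K := ℝ)] at hd
    have : (((((2 : ℕ) : ℚ) / (((48 * k + 47 : ℕ) : ℚ) + 1) : ℚ)) : ℝ) = 2 * δ := by
      rw [hδd]; push_cast; ring
    rw [this] at hd
    have h' := (abs_lt.1 (hNspec i (.sub (.mul p r) r) (48 * k + 47))).1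
    rw [eval_sub, eval_mul, ← hδd] at h'
    linarith
  simp only [T, Bool.and_eq_true, decide_eq_true_eq] at h
  have hk : (0 : ℝ) < (k : ℝ) + 1 := by positivity
  have hδk : 3 * δ = 1 / (16 * ((k : ℝ) + 1)) := by
    rw [hδd]; push_cast; field_simp; ring
  have hfin := norm_sub_one_le_of_chain (A := i.carrier) (n := i.numComponents) rfl
    i.numComponents_pos (δ := 3 * δ)
    (by
      rw [hδk]
      exact one_div_le_one_div_of_le (by norm_num) (by linarith [k.cast_nonneg (α := ℝ)]))
    (q := fun l => i.eval (ratStarPoly (codedSeq (L i k) l)))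
    (fun l hl => hDs l _ _ (h l hl).1.1.1) (fun l hl => hDs l _ _ (h l hl).1.1.2)
    (fun l hl => hDs l _ _ (h l hl).1.2) (fun l hl => by
      have h1 := (h l hl).2
      rw [← Rat.cast_lt (K := ℝ)] at h1
      have h' := (abs_lt.1 (hNspec i (.sub (Q' i ((k, L i k), l)) (Q i ((k, L i k), l)))
        (48 * k + 47))).2
      rw [eval_sub, ← hδd] at h'
      have : (((1 / 2 + ((1 : ℕ) : ℚ) / (((48 * k + 47 : ℕ) : ℚ) + 1) : ℚ)) : ℝ) =
        1 / 2 + δ := by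
        rw [hδd]; push_cast; ring
      simp only [M] at h1
      rw [this] at h1
      simp only [Q, Q'] at h1 h'
      linarith)
  refine hfin.trans ?_
  rw [hδk]
  rw [mul_one_div, div_le_div_iff₀ (by positivity) hk]
  linarith

end NamedAlgebra

/-! ## The spectrum in coordinates -/

theorem character_apply_star {A : Type*} [CommCStarAlgebra A] (φ : characterSpace ℂ A) (a : A) :
    φ (star a) = star (φ a) :=
  DFunLike.congr_fun (gelfandTransform_map_star a) φ

/-- The rational number that is coded by the `l`-th entry of a finite sequence. -/
def codedRat (c l : ℕ) : ℚ := ratOfCode (codedSeq c l)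

theorem exists_codedRat_eq (v : ℕ → ℚ) (m : ℕ) : ∃ c, ∀ l < m, codedRat c l = v l := by
  choose w hw using fun l => ratOfCode_surjective (v l)
  obtain ⟨c, hc⟩ := exists_codedSeq_eq w m
  exact ⟨c, fun l hl => by rw [codedRat, hc l hl, hw]⟩

/-- The self-adjoint polynomials `x_m + x_m⋆` and `i (x_m - x_m⋆)`, in one sequence. -/
def coordPoly (l : ℕ) : RatStarPoly :=
  bif l.bodd then .smul (0, RatCode.divSucc 1 0)
    (.sub (.letter (l.div2, false)) (.letter (l.div2, true)))
  else .letter (l.div2, false) ++ .letter (l.div2, true)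

theorem primrec_coordPoly : Primrec coordPoly := by
  have h : ∀ b : Bool, Primrec fun l : ℕ => RatStarPoly.letter (l.div2, b) := fun b =>
    RatStarPoly.primrec_letter.comp (Primrec.pair Primrec.nat_div2 (.const b))
  exact Primrec.cond Primrec.nat_bodd
    (RatStarPoly.primrec_smul.comp (.const _) (RatStarPoly.primrec_sub.comp (h false) (h true)))
    (Primrec.list_append.comp (h false) (h true))

/-- The polynomial `∑ (a_l ^ 2 - 2 λ_l a_l)`, for the first `m` coordinate polynomials `a_l` and the
rational numbers `λ_l` coded by `c`. -/
def gapPoly (a : ℕ × ℕ) : RatStarPoly :=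
  (List.range a.1).flatMap fun l => RatStarPoly.mul (coordPoly l) (coordPoly l) ++
    RatStarPoly.smul (RatCode.mul (RatCode.neg (RatCode.divSucc 2 0)) (codedSeq a.2 l), 0) (coordPoly l)

theorem primrec_gapPoly : Primrec gapPoly := by
  have h : Primrec₂ fun (_ : ℕ × ℕ) (l : ℕ) => coordPoly l := primrec_coordPoly.comp .snd
  refine Primrec.list_flatMap (Primrec.list_range.comp .fst) (Primrec.list_append.comp
    (RatStarPoly.primrec_mul.comp h h) (RatStarPoly.primrec_smul.comp (Primrec.pair ?_ (.const 0)) h))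
  exact RatCode.primrec_mul.comp (.const _)
    (primrec_codedSeq.comp (Primrec.snd.comp .fst) .snd)

namespace NamedAlgebra

theorem exists_norm_bound :
    ∃ b : NamedAlgebra.{u} → RatStarPoly → ℕ, IsComputable b ∧ ∀ i p, ‖i.eval p‖ ≤ b i p := by
  obtain ⟨N, ⟨κ, hκ, hκN⟩, hN⟩ := exists_norm_approx.{u}
  refine ⟨fun i p => (κ i (p, 0)).unpair.1.unpair.1 + 1, .natAdd (.unpairFst (.unpairFst
    (hκ.comp (.pair .id (.const 0))))) (.const 1), fun i p => ?_⟩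
  have h := (abs_lt.1 (hN i p 0)).1
  -- The rational `(a - b) / (c + 1)` is at most `a`, and the added `1` absorbs the error of the
  -- norm.
  have h' : ∀ n, ratOfCode n ≤ n.unpair.1.unpair.1 := fun n => by
    rw [ratOfCode, div_le_iff₀ (by positivity)]
    have h1 : (0 : ℚ) ≤ n.unpair.1.unpair.1 := by positivity
    have h2 : (0 : ℚ) ≤ n.unpair.1.unpair.2 := by positivity
    have h3 : (0 : ℚ) ≤ n.unpair.2 := by positivity
    nlinarith
  have h2 := h' (κ i (p, 0))
  rw [hκN, ← Rat.cast_le (K := ℝ)] at h2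
  push_cast at h2 h ⊢
  norm_num at h
  linarith

/-- The minimum over the spectrum of a rational vector with real values is uniformly computable. -/
theorem exists_min_approx :
    ∃ q : NamedAlgebra.{u} → RatStarPoly × ℕ → ℚ, IsComputableRat q ∧
      ∀ (i : NamedAlgebra.{u}) p m, (∀ φ : i.Spectrum, (φ (i.eval p)).im = 0) →
        (∀ φ : i.Spectrum, q i (p, m) - 1 / ((m : ℝ) + 1) < (φ (i.eval p)).re) ∧
        ∃ φ : i.Spectrum, (φ (i.eval p)).re < q i (p, m) + 1 / ((m : ℝ) + 1) := by
  obtain ⟨N, hN, hNspec⟩ := exists_norm_approx.{u}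
  obtain ⟨e, he, hespec⟩ := exists_unit_approx.{u}
  obtain ⟨b, hb, hbspec⟩ := exists_norm_bound.{u}
  -- A rational stand-in for `B • 1 - p`. The error of the approximate unit is multiplied by `B`, so
  -- the precision `2 * B * (m + 1)` keeps it below half of `1 / (m + 1)`.
  let W : NamedAlgebra.{u} → RatStarPoly × ℕ → RatStarPoly := fun i a =>
    .sub (.smul (RatCode.divSucc (b i a.1) 0, 0) (e i (2 * b i a.1 * (a.2 + 1)))) a.1
  have hb1 : IsComputable fun i (a : RatStarPoly × ℕ) => b i a.1 := hb.comp UniformComputable.id.fst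
  have hW : IsComputable W := by
    refine .map₂ (f := RatStarPoly.sub) RatStarPoly.primrec_sub.to_comp
      (.map₂ (f := RatStarPoly.smul) RatStarPoly.primrec_smul.to_comp
        (.pair (.map₂ RatCode.primrec_divSucc.to_comp hb1 (.const 0)) (.const 0)) ?_)
      UniformComputable.id.fst
    exact he.comp (.natMul (.natMul (.const 2) hb1) (.natAdd UniformComputable.id.snd (.const 1)))
  refine ⟨fun i a => (b i a.1 : ℚ) - N i (W i a, 2 * a.2 + 1), .sub (.natCast hb1)
    (hN.comp (.pair hW (.natAdd (.natMul (.const 2) UniformComputable.id.snd) (.const 1)))),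
    fun i p m hp => ?_⟩
  set B : ℝ := ((b i p : ℕ) : ℝ) with hB
  have hB0 : 0 ≤ B := Nat.cast_nonneg _
  set R : ℝ := ‖(B : ℂ) • (1 : i.carrier) - i.eval p‖ with hR
  set ε : ℝ := 1 / ((m : ℝ) + 1) with hε
  have hm : (0 : ℝ) < (m : ℝ) + 1 := by positivity
  have hWR : |‖i.eval (W i (p, m))‖ - R| ≤ ε / 2 := by
    have e1 : i.eval (W i (p, m)) - ((B : ℂ) • (1 : i.carrier) - i.eval p) =
        (B : ℂ) • (i.eval (e i (2 * b i p * (m + 1))) - 1) := by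
      simp only [W, eval_sub, eval_smul, complexOfCode, RatCode.ratOfCode_divSucc, ratOfCode_zero]
      rw [smul_sub]
      simp [hB]
    refine (abs_norm_sub_norm_le _ _).trans ?_
    rw [e1, norm_smul, Complex.norm_real, Real.norm_of_nonneg hB0]
    refine (mul_le_mul_of_nonneg_left (hespec i _) hB0).trans ?_
    rw [hε, mul_one_div, div_div, div_le_div_iff₀ (by positivity) (by positivity)]
    push_cast
    rw [← hB]
    nlinarith
  have hNR : |(N i (W i (p, m), 2 * m + 1) : ℝ) - R| < ε := by
    have h := hNspec i (W i (p, m)) (2 * m + 1)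
    have e2 : 1 / ((((2 * m + 1 : ℕ) : ℝ)) + 1) = ε / 2 := by
      rw [hε]; push_cast; field_simp; ring
    rw [e2] at h
    calc _ = |((N i (W i (p, m), 2 * m + 1) : ℝ) - ‖i.eval (W i (p, m))‖) +
          (‖i.eval (W i (p, m))‖ - R)| := by ring_nf
      _ ≤ _ := abs_add_le _ _
      _ < ε := by linarith
  rw [abs_lt] at hNR
  have hφ : ∀ φ : i.Spectrum, ‖φ ((B : ℂ) • (1 : i.carrier) - i.eval p)‖ =
      B - (φ (i.eval p)).re := by
    intro φ
    have h1 : φ (i.eval p) = ((φ (i.eval p)).re : ℂ) :=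
      Complex.ext (by simp) (by simp [hp φ])
    have h2 : (φ (i.eval p)).re ≤ B :=
      (Complex.re_le_norm _).trans ((norm_character_apply_le φ _).trans (hbspec i p))
    rw [map_sub, map_smul, map_one, h1, smul_eq_mul, mul_one, ← Complex.ofReal_sub,
      Complex.norm_real, Complex.ofReal_re, Real.norm_of_nonneg (by linarith)]
  push_cast
  rw [← hB]
  refine ⟨fun φ => ?_, ?_⟩
  · have h := norm_character_apply_le φ ((B : ℂ) • (1 : i.carrier) - i.eval p)
    rw [hφ φ] at h
    linarith [hNR.2]
  -- The lemma producing a character needs a nonnegative bound; for a negative one any character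
  -- serves.
  · rcases lt_or_ge ((N i (W i (p, m), 2 * m + 1) : ℝ) - ε) 0 with h0 | h0
    · obtain ⟨φ⟩ := (inferInstance : Nonempty i.Spectrum)
      have h := norm_nonneg (φ ((B : ℂ) • (1 : i.carrier) - i.eval p))
      rw [hφ φ] at h
      exact ⟨φ, by linarith⟩
    · obtain ⟨φ, h⟩ := exists_lt_norm_character_apply h0
        (show (N i (W i (p, m), 2 * m + 1) : ℝ) - ε < R by linarith)
      rw [hφ φ] at h
      exact ⟨φ, by linarith⟩

variable (i : NamedAlgebra.{u})

/-- The coordinates of a point of the spectrum. -/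
noncomputable def coord (l : ℕ) (φ : i.Spectrum) : ℝ := (φ (i.eval (coordPoly l))).re

theorem continuous_coord (l : ℕ) : Continuous (i.coord l) :=
  Complex.continuous_re.comp (continuous_character_apply _)

theorem apply_coordPoly_two_mul (φ : i.Spectrum) (m : ℕ) :
    φ (i.eval (coordPoly (2 * m))) = ((2 * (φ (i.pres.gen m)).re : ℝ) : ℂ) := by
  have h1 : (2 * m).bodd = false := by simp
  have h2 : (2 * m).div2 = m := by rw [Nat.div2_val]; omega
  rw [coordPoly, h1, h2, cond_false, eval_append, map_add, eval, eval, RatStarPoly.eval_letter,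
    RatStarPoly.eval_letter]
  simp only [evalLetter, Bool.false_eq_true, if_false, if_true, character_apply_star]
  exact Complex.add_conj _

theorem apply_coordPoly_two_mul_add_one (φ : i.Spectrum) (m : ℕ) :
    φ (i.eval (coordPoly (2 * m + 1))) = ((-2 * (φ (i.pres.gen m)).im : ℝ) : ℂ) := by
  have h1 : (2 * m + 1).bodd = true := by simp
  have h2 : (2 * m + 1).div2 = m := by rw [Nat.div2_val]; omega
  have h3 : complexOfCode (0, RatCode.divSucc 1 0) = Complex.I := by
    simp [complexOfCode, RatCode.ratOfCode_divSucc, ratOfCode_zero]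
  rw [coordPoly, h1, h2, cond_true, eval_smul, eval_sub, map_smul, map_sub, eval, eval,
    RatStarPoly.eval_letter, RatStarPoly.eval_letter, h3]
  simp only [evalLetter, Bool.false_eq_true, if_false, if_true, character_apply_star]
  apply Complex.ext <;> simp
  ring

theorem apply_coordPoly (φ : i.Spectrum) (l : ℕ) :
    φ (i.eval (coordPoly l)) = (i.coord l φ : ℂ) := by
  obtain ⟨m, rfl | rfl⟩ := l.even_or_odd'
  · rw [coord, apply_coordPoly_two_mul, Complex.ofReal_re]
  · rw [coord, apply_coordPoly_two_mul_add_one, Complex.ofReal_re]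

/-- The coordinates `2 * m` and `2 * m + 1` are `2 Re` and `-2 Im` of the value at the `m`-th
generator. A character is a continuous ⋆-homomorphism, hence determined by its values at the
generators. -/
theorem ext_coord {φ ψ : i.Spectrum} (h : ∀ l, i.coord l φ = i.coord l ψ) : φ = ψ := by
  have hgen : ∀ m, φ (i.pres.gen m) = ψ (i.pres.gen m) := by
    intro m
    have h1 := h (2 * m)
    have h2 := h (2 * m + 1)
    rw [coord, coord, apply_coordPoly_two_mul, apply_coordPoly_two_mul] at h1
    rw [coord, coord, apply_coordPoly_two_mul_add_one, apply_coordPoly_two_mul_add_one] at h2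
    rw [Complex.ofReal_re, Complex.ofReal_re] at h1 h2
    exact Complex.ext (by linarith) (by linarith)
  have hadj : Set.EqOn φ ψ (NonUnitalStarAlgebra.adjoin ℂ (Set.range i.pres.gen)) := by
    intro x hx
    induction hx using NonUnitalStarAlgebra.adjoin_induction with
    | mem x hx => obtain ⟨m, rfl⟩ := hx; exact hgen m
    | add x y _ _ hx hy => rw [map_add, map_add, hx, hy]
    | zero => rw [map_zero, map_zero]
    | mul x y _ _ hx hy => rw [map_mul, map_mul, hx, hy]
    | smul c x _ hx => rw [map_smul, map_smul, hx]
    | star x _ hx => rw [character_apply_star, character_apply_star, hx]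
  exact DFunLike.coe_injective (Continuous.ext_on i.pres.dense (map_continuous φ)
    (map_continuous ψ) hadj)

/-- Adding the constant `∑ λ_l ^ 2` completes the squares to `∑ (a_l - λ_l) ^ 2`. The constant is
kept outside the polynomial because the free algebra has no unit. -/
theorem apply_gapPoly (φ : i.Spectrum) (m c : ℕ) :
    φ (i.eval (gapPoly (m, c))) =
      ((∑ l ∈ Finset.range m, (i.coord l φ ^ 2 - 2 * codedRat c l * i.coord l φ) : ℝ) : ℂ) := by
  induction m with
  | zero =>
    have h : i.eval (gapPoly (0, c)) = 0 := RatStarPoly.eval_nil _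
    simp [h]
  | succ m ih =>
    have h : gapPoly (m + 1, c) = gapPoly (m, c) ++ (RatStarPoly.mul (coordPoly m) (coordPoly m) ++
        RatStarPoly.smul (RatCode.mul (RatCode.neg (RatCode.divSucc 2 0)) (codedSeq c m), 0)
          (coordPoly m)) := by
      simp [gapPoly, List.range_succ]
    rw [h, eval_append, map_add, ih, eval_append, eval_mul, eval_smul, map_add, map_mul, map_smul,
      apply_coordPoly, Finset.sum_range_succ]
    simp only [complexOfCode, RatCode.ratOfCode_mul, RatCode.ratOfCode_neg,
      RatCode.ratOfCode_divSucc, ratOfCode_zero, codedRat, smul_eq_mul]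
    push_cast
    ring

/-- Whether a finite sequence of rational numbers is close to the coordinates of a point of the
spectrum can be decided up to a factor. -/
theorem exists_isGood :
    ∃ good : NamedAlgebra.{u} → ℕ × ℕ → Bool, IsComputable good ∧
      (∀ (i : NamedAlgebra.{u}) m c, good i (m, c) = true →
        ∃ φ : i.Spectrum, ∀ l < m, |i.coord l φ - codedRat c l| < (1 / 2) ^ m) ∧
      ∀ (i : NamedAlgebra.{u}) m c,
        (∃ φ : i.Spectrum, ∀ l < m, |i.coord l φ - codedRat c l| ≤ (1 / 4) ^ (m + 1)) →
          good i (m, c) = true := by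
  obtain ⟨q, hq, hqspec⟩ := exists_min_approx.{u}
  have hgap : IsComputable fun (_ : NamedAlgebra.{u}) a => gapPoly a :=
    .of_computable primrec_gapPoly.to_comp
  have hrat : IsComputableRat fun (_ : NamedAlgebra.{u}) (t : (ℕ × ℕ) × ℕ) =>
      codedRat t.1.2 t.2 := .ofCode (.map₂ (f := codedSeq) primrec_codedSeq.to_comp
        UniformComputable.id.fst.snd UniformComputable.id.snd)
  have hK : IsComputable fun (_ : NamedAlgebra.{u}) (a : ℕ × ℕ) => 4 ^ (a.1 + 1) - 1 :=
    .natSub (.natPow (.const 4) (.natAdd UniformComputable.id.fst (.const 1))) (.const 1)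
  -- With `η = 1 / 4 ^ (m + 1)`, the minimum of the sum of squares is known up to `η` and compared
  -- with `2 * η`. Passing yields a point with sum below `3 * η < 4 * η = ((1 / 2) ^ m) ^ 2`. A
  -- point with all differences at most `η` has sum at most `m * η ^ 2 ≤ η`, so the test passes.
  let good : NamedAlgebra.{u} → ℕ × ℕ → Bool := fun i a =>
    decide (∑ l ∈ Finset.range a.1, codedRat a.2 l * codedRat a.2 l +
      q i (gapPoly a, 4 ^ (a.1 + 1) - 1) < ((2 : ℕ) : ℚ) / (((4 ^ (a.1 + 1) - 1 : ℕ) : ℚ) + 1))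
  have hgood : IsComputable good := UniformComputableRat.lt
    (.add (UniformComputableRat.sum_range (hrat.mul hrat) UniformComputable.id.fst)
      (hq.comp (.pair hgap hK))) (.divSucc (.const 2) hK)
  have hcast : ∀ m : ℕ, (((4 ^ (m + 1) - 1 : ℕ) : ℝ)) + 1 = 4 ^ (m + 1) := fun m => by
    have h : 4 ^ (m + 1) - 1 + 1 = 4 ^ (m + 1) := Nat.sub_add_cancel (Nat.one_le_pow _ _ (by norm_num))
    exact_mod_cast h
  have hsum : ∀ (i : NamedAlgebra.{u}) (φ : i.Spectrum) m c,
      ∑ l ∈ Finset.range m, (i.coord l φ - codedRat c l) ^ 2 =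
        ∑ l ∈ Finset.range m, (codedRat c l : ℝ) * codedRat c l +
          (φ (i.eval (gapPoly (m, c)))).re := fun i φ m c => by
    rw [apply_gapPoly, Complex.ofReal_re, ← Finset.sum_add_distrib]
    exact Finset.sum_congr rfl fun l _ => by ring
  have hiff : ∀ i m c, good i (m, c) = true ↔
      ∑ l ∈ Finset.range m, (codedRat c l : ℝ) * codedRat c l +
        q i (gapPoly (m, c), 4 ^ (m + 1) - 1) < 2 * (1 / 4 ^ (m + 1)) := fun i m c => by
    simp only [good, decide_eq_true_eq]
    rw [← Rat.cast_lt (K := ℝ)]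
    rw [Rat.cast_div, Rat.cast_add, Rat.cast_natCast, Rat.cast_add, Rat.cast_natCast, Rat.cast_one,
      hcast, Rat.cast_sum]
    push_cast
    rw [mul_one_div]
  have hspec := fun (i : NamedAlgebra.{u}) m c => hqspec i (gapPoly (m, c)) (4 ^ (m + 1) - 1)
    (fun φ => by rw [apply_gapPoly, Complex.ofReal_im])
  simp only [hcast] at hspec
  refine ⟨good, hgood, fun i m c h => ?_, fun i m c ⟨φ, hφ⟩ => ?_⟩
  · rw [hiff] at h
    obtain ⟨φ, hφ⟩ := (hspec i m c).2
    refine ⟨φ, fun l hl => ?_⟩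
    have h1 : (i.coord l φ - codedRat c l) ^ 2 ≤
        ∑ l ∈ Finset.range m, (i.coord l φ - codedRat c l) ^ 2 :=
      Finset.single_le_sum (f := fun l => (i.coord l φ - codedRat c l) ^ 2)
        (fun _ _ => sq_nonneg _) (Finset.mem_range.2 hl)
    rw [hsum] at h1
    refine abs_lt_of_sq_lt_sq ?_ (by positivity)
    have h2 : (((1 : ℝ) / 2) ^ m) ^ 2 = 4 * (1 / 4 ^ (m + 1)) := by
      have h4 : ((1 : ℝ) / 2) ^ 2 = 1 / 4 := by norm_num
      rw [← pow_mul, mul_comm m 2, pow_mul, h4, one_div_pow, pow_succ (4 : ℝ) m]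
      field_simp
    have h3 : (0 : ℝ) < 1 / 4 ^ (m + 1) := by positivity
    rw [h2]
    linarith
  · rw [hiff]
    have h1 := (hspec i m c).1 φ
    have h2 : ∑ l ∈ Finset.range m, (i.coord l φ - codedRat c l) ^ 2 ≤ 1 / 4 ^ (m + 1) := by
      calc ∑ l ∈ Finset.range m, (i.coord l φ - codedRat c l) ^ 2
          ≤ ∑ l ∈ Finset.range m, (((1 : ℝ) / 4) ^ (m + 1)) ^ 2 :=
            Finset.sum_le_sum fun l hl => by
              rw [← sq_abs]
              exact pow_le_pow_left₀ (abs_nonneg _) (hφ l (Finset.mem_range.1 hl)) 2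
        _ = ((m : ℝ) / 4 ^ (m + 1)) * (1 / 4 ^ (m + 1)) := by
          rw [Finset.sum_const, Finset.card_range, nsmul_eq_mul, one_div_pow]
          ring
        _ ≤ 1 * (1 / 4 ^ (m + 1)) := by
          refine mul_le_mul_of_nonneg_right ?_ (by positivity)
          rw [div_le_one (by positivity)]
          exact_mod_cast (Nat.lt_pow_self (by norm_num)).le.trans
            (Nat.pow_le_pow_right (by norm_num) (Nat.le_succ m))
        _ = _ := one_mul _
    rw [hsum] at h2
    linarith

end NamedAlgebra

/-! ## A computable sequence of points of the spectrum -/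

theorem UniformComputableRat.halfPow {ι : Type*} {orc : ι → ℕ → ℕ} {prm : ι → ℕ} {α : Type*}
    [Primcodable α] {Φ : ι → α → ℕ} (hΦ : UniformComputable orc prm Φ) :
    UniformComputableRat orc prm fun i a => (1 / 2 : ℚ) ^ Φ i a := by
  convert UniformComputableRat.divSucc (.const 1)
    (UniformComputable.natSub (.natPow (.const 2) hΦ) (.const 1)) using 3 with i a
  have h : 2 ^ Φ i a - 1 + 1 = 2 ^ Φ i a := Nat.sub_add_cancel (Nat.one_le_pow _ _ (by norm_num))
  have h' : ((2 ^ Φ i a - 1 : ℕ) : ℚ) + 1 = 2 ^ Φ i a := by exact_mod_cast h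
  rw [h', one_div_pow, Nat.cast_one]

theorem exists_rat_abs_sub_le (x : ℝ) {ε : ℝ} (hε : 0 < ε) : ∃ r : ℚ, |x - r| ≤ ε := by
  obtain ⟨r, h1, h2⟩ := exists_rat_btwn (show x - ε < x by linarith)
  exact ⟨r, by rw [abs_le]; constructor <;> linarith⟩

namespace NamedAlgebra

/-- A good approximation of a point in `m` coordinates can be refined to one in `m + 1`
coordinates. -/
theorem exists_refine {good : NamedAlgebra.{u} → ℕ × ℕ → Bool} (hgood : IsComputable good)
    (h1 : ∀ (i : NamedAlgebra.{u}) m c, good i (m, c) = true →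
      ∃ φ : i.Spectrum, ∀ l < m, |i.coord l φ - codedRat c l| < (1 / 2) ^ m)
    (h2 : ∀ (i : NamedAlgebra.{u}) m c,
      (∃ φ : i.Spectrum, ∀ l < m, |i.coord l φ - codedRat c l| ≤ (1 / 4) ^ (m + 1)) →
        good i (m, c) = true) :
    ∃ ρ : NamedAlgebra.{u} → ℕ × ℕ → ℕ, IsComputable ρ ∧
      ∀ (i : NamedAlgebra.{u}) m c, good i (m, c) = true → good i (m + 1, ρ i (m, c)) = true ∧
        ∀ l < m, |(codedRat (ρ i (m, c)) l : ℝ) - codedRat c l| ≤ 2 * (1 / 2) ^ m := by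
  let S : NamedAlgebra.{u} → ((ℕ × ℕ) × ℕ) × ℕ → Bool := fun _ t =>
    decide (|codedRat t.1.2 t.2 - codedRat t.1.1.2 t.2| < 2 * (1 / 2) ^ t.1.1.1)
  have hS : IsComputable S := by
    refine UniformComputableRat.lt (.abs (.sub (.ofCode ?_) (.ofCode ?_)))
      (.mul (.const 2) (.halfPow UniformComputable.id.fst.fst.fst))
    · exact .map₂ (f := codedSeq) primrec_codedSeq.to_comp UniformComputable.id.fst.snd
        UniformComputable.id.snd
    · exact .map₂ (f := codedSeq) primrec_codedSeq.to_comp UniformComputable.id.fst.fst.snd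
        UniformComputable.id.snd
  -- The first alternative makes the search stop on inputs that are not good, where nothing is
  -- claimed.
  let T : NamedAlgebra.{u} → (ℕ × ℕ) × ℕ → Bool := fun i t =>
    !good i t.1 || (good i (t.1.1 + 1, t.2) && decide (∀ l < t.1.1, S i (t, l) = true))
  have hT : IsComputable T := (hgood.comp UniformComputable.id.fst).not.or
    (.and (hgood.comp (.pair (.natAdd UniformComputable.id.fst.fst (.const 1))
      UniformComputable.id.snd)) (hS.forall_lt UniformComputable.id.fst.fst))
  have hex : ∀ (i : NamedAlgebra.{u}) (a : ℕ × ℕ), ∃ c, T i (a, c) = true := by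
    rintro i ⟨m, c⟩
    by_cases hg : good i (m, c) = true
    · obtain ⟨φ, hφ⟩ := h1 i m c hg
      set ε : ℝ := (1 / 4) ^ (m + 2) with hε
      choose r hr using fun l => exists_rat_abs_sub_le (i.coord l φ) (show 0 < ε by positivity)
      obtain ⟨c', hc'⟩ := exists_codedRat_eq r (m + 1)
      refine ⟨c', ?_⟩
      have hε' : ε ≤ (1 / 2) ^ m :=
        (pow_le_pow_left₀ (by norm_num) (by norm_num) _).trans
          (pow_le_pow_of_le_one (by norm_num) (by norm_num) (Nat.le_add_right m 2))
      have hg' : good i (m + 1, c') = true := h2 i (m + 1) c' ⟨φ, fun l hl => by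
        rw [hc' l hl]; exact hr l⟩
      simp only [T, hg, hg', Bool.not_true, Bool.false_or, Bool.true_and, decide_eq_true_eq, S]
      intro l hl
      rw [← Rat.cast_lt (K := ℝ), hc' l (by omega)]
      push_cast
      have h3 := hφ l hl
      have h4 := hr l
      rw [abs_lt] at h3 ⊢
      rw [abs_le] at h4
      constructor <;> linarith
    · exact ⟨0, by simp [T, hg]⟩
  obtain ⟨ρ, hρ, hρT⟩ := UniformComputable.exists_choice hT hex
  refine ⟨ρ, hρ, fun i m c hg => ?_⟩
  have h := hρT i (m, c)
  simp only [T, hg, Bool.not_true, Bool.false_or, Bool.and_eq_true, decide_eq_true_eq, S] at h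
  refine ⟨h.1, fun l hl => ?_⟩
  have h3 := h.2 l hl
  rw [← Rat.cast_lt (K := ℝ)] at h3
  push_cast at h3
  exact h3.le

/-- There is a sequence of points of the spectrum whose coordinates are uniformly computable and
which follows all good approximations. -/
theorem exists_points :
    ∃ path : NamedAlgebra.{u} → ℕ × ℕ → ℕ, IsComputable path ∧
      ∃ s : ∀ i : NamedAlgebra.{u}, ℕ → i.Spectrum,
        (∀ i k t, ∀ l < t, |i.coord l (s i k) - codedRat (path i (k, t)) l| ≤ 4 * (1 / 2) ^ t) ∧
        ∀ (i : NamedAlgebra.{u}) m c,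
          (∃ φ : i.Spectrum, ∀ l < m, |i.coord l φ - codedRat c l| ≤ (1 / 4) ^ (m + 1)) →
            ∀ l < m, |i.coord l (s i (Nat.pair m c)) - codedRat c l| ≤ 4 * (1 / 2) ^ m := by
  obtain ⟨good, hgood, h1, h2⟩ := exists_isGood.{u}
  obtain ⟨ρ, hρ, hρgood⟩ := exists_refine hgood h1 h2
  have hun : IsComputable fun (_ : NamedAlgebra.{u}) (k : ℕ) => k.unpair :=
    .of_computable Primrec.unpair.to_comp
  -- The default `(0, 0)` is always good: it constrains no coordinate, and the spectrum is nonempty.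
  let start : NamedAlgebra.{u} → ℕ → ℕ × ℕ := fun i k =>
    if good i k.unpair then k.unpair else (0, 0)
  have hstart : IsComputable start := .ite (hgood.comp hun) hun (.const (0, 0))
  let path : NamedAlgebra.{u} → ℕ × ℕ → ℕ := fun i p =>
    p.2.rec (start i p.1).2 fun t c => ρ i ((start i p.1).1 + t, c)
  have hpath : IsComputable path := .natRec (Φ := fun i k => (start i k).2)
    (Ψ := fun i (p : ℕ × ℕ × ℕ) => ρ i ((start i p.1).1 + p.2.1, p.2.2)) hstart.snd
    (hρ.comp (.pair (.natAdd (hstart.comp UniformComputable.id.fst).fst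
      UniformComputable.id.snd.fst) UniformComputable.id.snd.snd))
  have hgoodpath : ∀ i k t, good i ((start i k).1 + t, path i (k, t)) = true := by
    intro i k t
    induction t with
    | zero =>
      by_cases h : good i k.unpair = true
      · simp [path, start, h]
      · obtain ⟨φ⟩ := (inferInstance : Nonempty i.Spectrum)
        simpa [path, start, h] using h2 i 0 0 ⟨φ, fun l hl => absurd hl (Nat.not_lt_zero l)⟩
    | succ t ih => exact (hρgood i _ _ ih).1
  -- The factor `4` makes these closed sets nested: at level `M`, a refinement moves entries by at
  -- most `2 * (1 / 2) ^ M`, and `4 * (1 / 2) ^ (M + 1) + 2 * (1 / 2) ^ M = 4 * (1 / 2) ^ M`. They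
  -- are nonempty by goodness, so by compactness they have a common point.
  let F : ∀ i : NamedAlgebra.{u}, ℕ → ℕ → Set i.Spectrum := fun i k t =>
    {φ | ∀ l < (start i k).1 + t,
      |i.coord l φ - codedRat (path i (k, t)) l| ≤ 4 * (1 / 2) ^ ((start i k).1 + t)}
  have hF : ∀ i k, (⋂ t, F i k t).Nonempty := by
    intro i k
    have hclosed : ∀ t, IsClosed (F i k t) := fun t => by
      have : F i k t = ⋂ l, ⋂ _ : l < (start i k).1 + t,
          {φ | |i.coord l φ - codedRat (path i (k, t)) l| ≤ 4 * (1 / 2) ^ ((start i k).1 + t)} := by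
        ext φ
        simp [F]
      rw [this]
      exact isClosed_iInter fun l => isClosed_iInter fun _ =>
        isClosed_le ((i.continuous_coord l).sub continuous_const).abs continuous_const
    refine IsCompact.nonempty_iInter_of_sequence_nonempty_isCompact_isClosed _ (fun t => ?_)
      (fun t => ?_) (hclosed 0).isCompact hclosed
    · intro φ hφ l hl
      have h3 := hφ l (by omega)
      have h4 := (hρgood i _ _ (hgoodpath i k t)).2 l hl
      have h5 : path i (k, t + 1) = ρ i ((start i k).1 + t, path i (k, t)) := rfl
      rw [← h5] at h4
      have h6 : ((1 : ℝ) / 2) ^ ((start i k).1 + (t + 1)) =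
          (1 / 2) ^ ((start i k).1 + t) * (1 / 2) := by
        rw [← add_assoc, pow_succ]
      rw [h6] at h3
      have := abs_sub_le (i.coord l φ) (codedRat (path i (k, t + 1)) l)
        (codedRat (path i (k, t)) l)
      linarith
    · obtain ⟨φ, hφ⟩ := h1 i _ _ (hgoodpath i k t)
      refine ⟨φ, fun l hl => (hφ l hl).le.trans ?_⟩
      have : (0 : ℝ) < (1 / 2) ^ ((start i k).1 + t) := by positivity
      linarith
  choose s hs using hF
  simp only [Set.mem_iInter] at hs
  refine ⟨path, hpath, s, fun i k t l hl => ?_, fun i m c h l hl => ?_⟩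
  · refine (hs i k t l (by omega)).trans ?_
    have : ((1 : ℝ) / 2) ^ ((start i k).1 + t) ≤ (1 / 2) ^ t :=
      pow_le_pow_of_le_one (by norm_num) (by norm_num) (Nat.le_add_left _ _)
    linarith
  · have hg := h2 i m c h
    have hst : start i (Nat.pair m c) = (m, c) := by simp [start, hg]
    have h3 := hs i (Nat.pair m c) 0 l (by rw [hst]; exact hl)
    have h4 : path i (Nat.pair m c, 0) = c := congrArg Prod.snd hst
    rw [h4, hst] at h3
    exact h3

end NamedAlgebra

/-! ## The metric of the spectrum -/

/-- The distance `∑ min (2 ^ (-l)) |x_l - y_l|` of real sequences is determined up to a small error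
by finitely many approximate differences. -/
theorem abs_tsum_min_sub_sum_le {x y r : ℕ → ℝ} {T : ℕ} {η : ℝ}
    (h : ∀ l < T, |x l - y l - r l| ≤ η) :
    |∑' l, min ((1 / 2) ^ l) |x l - y l| - (∑ l ∈ Finset.range T, min ((1 / 2) ^ l) |r l|)| ≤
      2 * (1 / 2) ^ T + T * η := by
  have hnn : ∀ l, 0 ≤ min (((1 : ℝ) / 2) ^ l) |x l - y l| := fun l =>
    le_min (by positivity) (abs_nonneg _)
  have hsum : Summable fun l => min (((1 : ℝ) / 2) ^ l) |x l - y l| :=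
    .of_nonneg_of_le hnn (fun l => min_le_left _ _) summable_geometric_two
  have htail : ∑' l, min (((1 : ℝ) / 2) ^ (l + T)) |x (l + T) - y (l + T)| ≤ 2 * (1 / 2) ^ T := by
    have hg : Summable fun l => ((1 : ℝ) / 2) ^ l * (1 / 2) ^ T :=
      summable_geometric_two.mul_right _
    have h1 := ((summable_nat_add_iff T).2 hsum).tsum_le_tsum
      (g := fun l => ((1 : ℝ) / 2) ^ l * (1 / 2) ^ T)
      (fun l => (min_le_left _ _).trans (pow_add _ _ _).le) hg
    rwa [tsum_mul_right, tsum_geometric_two] at h1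
  have htail0 : 0 ≤ ∑' l, min (((1 : ℝ) / 2) ^ (l + T)) |x (l + T) - y (l + T)| :=
    tsum_nonneg fun l => hnn (l + T)
  have hfin : |∑ l ∈ Finset.range T, min (((1 : ℝ) / 2) ^ l) |x l - y l| -
      (∑ l ∈ Finset.range T, min ((1 / 2) ^ l) |r l|)| ≤ T * η := by
    rw [← Finset.sum_sub_distrib]
    refine (Finset.abs_sum_le_sum_abs _ _).trans ?_
    refine (Finset.sum_le_card_nsmul _ _ η fun l hl => ?_).trans (by simp)
    refine (abs_min_sub_min_le_max _ _ _ _).trans (max_le ?_ ?_)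
    · rw [sub_self, abs_zero]
      exact (abs_nonneg _).trans (h l (Finset.mem_range.1 hl))
    · exact (abs_abs_sub_abs_le _ _).trans (h l (Finset.mem_range.1 hl))
  rw [← hsum.sum_add_tsum_nat_add T]
  rw [abs_le] at hfin ⊢
  constructor <;> linarith

/-- Fixes the truncation at `2 * t + 8` coordinates: `(1 / 2) ^ (2 * t + 8)` is `(1 / 2) ^ t * (1 /
2) ^ t / 256`, and one factor `(1 / 2) ^ t` absorbs the linear term in `t`. -/
theorem two_mul_half_pow_add_lt (t : ℕ) :
    2 * ((1 : ℝ) / 2) ^ (2 * t + 8) + ((2 * t + 8 : ℕ) : ℝ) * (8 * (1 / 2) ^ (2 * t + 8)) <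
      (1 / 2) ^ t := by
  have h : ((1 : ℝ) / 2) ^ (2 * t + 8) = (1 / 2) ^ t * (1 / 2) ^ t * (1 / 256) := by
    rw [pow_add, two_mul, pow_add]; norm_num
  have h1 : ((1 : ℝ) / 2) ^ t * t ≤ 1 := by
    rw [one_div_pow, one_div_mul_eq_div, div_le_one (by positivity)]
    exact_mod_cast (Nat.lt_pow_self (by norm_num)).le
  have h2 : ((1 : ℝ) / 2) ^ t ≤ 1 := pow_le_one₀ (by norm_num) (by norm_num)
  have h3 : (0 : ℝ) < (1 / 2) ^ t := by positivity
  rw [h]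
  push_cast
  nlinarith

namespace NamedAlgebra

variable (i : NamedAlgebra.{u})

/-- The coordinates of a point of the spectrum, as one sequence. -/
noncomputable def coords (φ : i.Spectrum) : ℕ → ℝ := fun l => i.coord l φ

/-- A continuous injection of a compact space into a Hausdorff space is a closed embedding. -/
theorem isEmbedding_coords : Topology.IsEmbedding i.coords :=
  (Continuous.isClosedEmbedding (continuous_pi i.continuous_coord)
    fun _ _ h => i.ext_coord (congrFun h)).isEmbedding

attribute [local instance] PiCountable.metricSpace in
/-- The metric that the spectrum inherits from the space of real sequences. -/
noncomputable abbrev spectrumMetric : MetricSpace i.Spectrum :=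
  Topology.IsEmbedding.comapMetricSpace i.coords i.isEmbedding_coords

/-- The distance of two points of the spectrum. -/
noncomputable def spectrumDist (φ ψ : i.Spectrum) : ℝ :=
  ∑' l, min ((1 / 2) ^ l) |i.coord l φ - i.coord l ψ|

theorem spectrumMetric_dist (φ ψ : i.Spectrum) :
    i.spectrumMetric.toPseudoMetricSpace.toDist.dist φ ψ = i.spectrumDist φ ψ := by
  have h : i.spectrumMetric.toPseudoMetricSpace.toDist.dist φ ψ =
    ∑' l, min ((2 : ℝ)⁻¹ ^ l) (dist (i.coord l φ) (i.coord l ψ)) := rfl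
  rw [h, spectrumDist]
  simp only [one_div, Real.dist_eq]

theorem spectrumDist_self (φ : i.Spectrum) : i.spectrumDist φ φ = 0 := by
  rw [← spectrumMetric_dist]
  exact i.spectrumMetric.toPseudoMetricSpace.dist_self φ

theorem spectrumDist_lt_half_pow {φ ψ : i.Spectrum} {t : ℕ}
    (h : ∀ l < 2 * t + 8, |i.coord l φ - i.coord l ψ| ≤ 8 * (1 / 2) ^ (2 * t + 8)) :
    i.spectrumDist φ ψ < (1 / 2) ^ t := by
  have h1 := abs_tsum_min_sub_sum_le (x := fun l => i.coord l φ) (y := fun l => i.coord l ψ)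
    (r := fun _ => 0) (T := 2 * t + 8) (η := 8 * (1 / 2) ^ (2 * t + 8))
    (fun l hl => by simpa using h l hl)
  have h2 : ∑ l ∈ Finset.range (2 * t + 8), min (((1 : ℝ) / 2) ^ l) |0| = 0 :=
    Finset.sum_eq_zero fun l _ => by rw [abs_zero]; exact min_eq_right (by positivity)
  rw [h2, sub_zero] at h1
  exact (le_abs_self _).trans_lt (h1.trans_lt (two_mul_half_pow_add_lt t))

/-- The presentation of the spectrum given by a dense sequence. -/
noncomputable def polishPresentation (s : ℕ → i.Spectrum) (hs : DenseRange s) :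
    PolishPresentation i.Spectrum where
  metric := i.spectrumMetric
  compatible := rfl
  complete := by
    let := i.spectrumMetric
    have : CompactSpace i.Spectrum := inferInstance
    exact complete_of_compact
  point := s
  dense := hs

theorem polishPresentation_distance (s : ℕ → i.Spectrum) (hs : DenseRange s) (φ ψ : i.Spectrum) :
    (i.polishPresentation s hs).distance φ ψ = i.spectrumDist φ ψ :=
  i.spectrumMetric_dist φ ψ

theorem denseRange_of_spectrumDist {s : ℕ → i.Spectrum}
    (h : ∀ φ t, ∃ k, i.spectrumDist φ (s k) < (1 / 2) ^ t) : DenseRange s := by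
  let := i.spectrumMetric
  refine Metric.denseRange_iff.2 fun φ r hr => ?_
  obtain ⟨t, ht⟩ := exists_pow_lt_of_lt_one hr (show (1 / 2 : ℝ) < 1 by norm_num)
  obtain ⟨k, hk⟩ := h φ t
  exact ⟨k, (i.spectrumMetric_dist φ (s k)).trans_lt (hk.trans ht)⟩

/-- The distances of the points of a sequence with computable coordinates are computable. -/
theorem exists_dist_approx {path : NamedAlgebra.{u} → ℕ × ℕ → ℕ} (hpath : IsComputable path)
    {s : ∀ i : NamedAlgebra.{u}, ℕ → i.Spectrum}
    (hs : ∀ i k t, ∀ l < t,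
      |i.coord l (s i k) - codedRat (path i (k, t)) l| ≤ 4 * (1 / 2) ^ t) :
    ∃ q : NamedAlgebra.{u} → (ℕ × ℕ) × ℕ → ℚ, IsComputableRat q ∧
      ∀ (i : NamedAlgebra.{u}) j k t,
        |i.spectrumDist (s i j) (s i k) - q i ((j, k), t)| < (1 / 2) ^ t := by
  have hT : IsComputable fun (_ : NamedAlgebra.{u}) (a : (ℕ × ℕ) × ℕ) => 2 * a.2 + 8 :=
    .natAdd (.natMul (.const 2) UniformComputable.id.snd) (.const 8)
  have hc : ∀ Φ : (ℕ × ℕ) × ℕ → ℕ, (IsComputable fun (_ : NamedAlgebra.{u}) a => Φ a) →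
      IsComputableRat fun (i : NamedAlgebra.{u}) (a : ((ℕ × ℕ) × ℕ) × ℕ) =>
        codedRat (path i (Φ a.1, 2 * a.1.2 + 8)) a.2 := fun Φ hΦ =>
    .ofCode (.map₂ (f := codedSeq) primrec_codedSeq.to_comp
      (hpath.comp (.pair (hΦ.comp UniformComputable.id.fst) (hT.comp UniformComputable.id.fst)))
      UniformComputable.id.snd)
  refine ⟨fun i a => ∑ l ∈ Finset.range (2 * a.2 + 8), min ((1 / 2) ^ l)
    |codedRat (path i (a.1.1, 2 * a.2 + 8)) l - codedRat (path i (a.1.2, 2 * a.2 + 8)) l|,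
    UniformComputableRat.sum_range (q := fun i (a : ((ℕ × ℕ) × ℕ) × ℕ) => min ((1 / 2) ^ a.2)
      |codedRat (path i (a.1.1.1, 2 * a.1.2 + 8)) a.2 -
        codedRat (path i (a.1.1.2, 2 * a.1.2 + 8)) a.2|)
      (.min (.halfPow UniformComputable.id.snd) (.abs (.sub
        (hc (fun a => a.1.1) UniformComputable.id.fst.fst)
        (hc (fun a => a.1.2) UniformComputable.id.fst.snd)))) hT, fun i j k t => ?_⟩
  refine lt_of_le_of_lt ?_ (two_mul_half_pow_add_lt t)
  have h := abs_tsum_min_sub_sum_le (x := fun l => i.coord l (s i j))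
    (y := fun l => i.coord l (s i k))
    (r := fun l => codedRat (path i (j, 2 * t + 8)) l - codedRat (path i (k, 2 * t + 8)) l)
    -- Each of the two points contributes an error `4 * (1 / 2) ^ T`.
    (T := 2 * t + 8) (η := 8 * (1 / 2) ^ (2 * t + 8)) fun l hl => by
      have h1 := hs i j _ l hl
      have h2 := hs i k _ l hl
      rw [abs_le] at h1 h2 ⊢
      constructor <;> linarith
  push_cast at h ⊢
  exact h

/-- A metric with computable distances of the special points has a computable name. -/
theorem exists_isName {q : NamedAlgebra.{u} → (ℕ × ℕ) × ℕ → ℚ} (hq : IsComputableRat q)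
    {s : ∀ i : NamedAlgebra.{u}, ℕ → i.Spectrum} (hs : ∀ i, DenseRange (s i))
    (hqs : ∀ (i : NamedAlgebra.{u}) j k t,
      |i.spectrumDist (s i j) (s i k) - q i ((j, k), t)| < (1 / 2) ^ t) :
    ∃ g : NamedAlgebra.{u} → ℕ → ℕ, IsComputable g ∧
      ∀ i : NamedAlgebra.{u}, (i.polishPresentation (s i) (hs i)).IsName (g i) := by
  -- The tuple `(-1, 0, 0, 1)` is in every diagram since `d(s_0, s_0) = 0`. It is the default output
  -- while a candidate is not yet certified.
  obtain ⟨w₀, hw₀⟩ : ∃ w, quadrupleOfCode w = (-1, 0, 0, 1) := by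
    obtain ⟨a, ha⟩ := ratOfCode_surjective (-1)
    obtain ⟨b, hb⟩ := ratOfCode_surjective 1
    exact ⟨Nat.pair a (Nat.pair (Nat.pair 0 0) b), by simp [quadrupleOfCode, ha, hb]⟩
  let Q : NamedAlgebra.{u} → ℕ → ℚ := fun i n =>
    q i ((n.unpair.1.unpair.2.unpair.1.unpair.1, n.unpair.1.unpair.2.unpair.1.unpair.2),
      n.unpair.2)
  let T : NamedAlgebra.{u} → ℕ → Bool := fun i n =>
    decide (ratOfCode n.unpair.1.unpair.1 + (1 / 2) ^ n.unpair.2 < Q i n) &&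
      decide (Q i n + (1 / 2) ^ n.unpair.2 < ratOfCode n.unpair.1.unpair.2.unpair.2)
  have hid : IsComputable fun (_ : NamedAlgebra.{u}) (n : ℕ) => n := UniformComputable.id
  have hQ : IsComputableRat Q := hq.comp (.pair (.pair
    (.unpairFst (.unpairFst (.unpairSnd (.unpairFst hid))))
    (.unpairSnd (.unpairFst (.unpairSnd (.unpairFst hid))))) (.unpairSnd hid))
  have hP : IsComputableRat fun (_ : NamedAlgebra.{u}) (n : ℕ) => (1 / 2 : ℚ) ^ n.unpair.2 :=
    .halfPow (.unpairSnd hid)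
  have hT : IsComputable T :=
    (UniformComputableRat.lt (.add (.ofCode (.unpairFst (.unpairFst hid))) hP) hQ).and
      (UniformComputableRat.lt (hQ.add hP) (.ofCode (.unpairSnd (.unpairSnd (.unpairFst hid)))))
  refine ⟨fun i n => if T i n then n.unpair.1 else w₀, .ite hT (.unpairFst hid) (.const w₀),
    fun i => ?_⟩
  have hTiff : ∀ n, T i n = true ↔
      (ratOfCode n.unpair.1.unpair.1 : ℝ) + (1 / 2) ^ n.unpair.2 < Q i n ∧
        (Q i n : ℝ) + (1 / 2) ^ n.unpair.2 < ratOfCode n.unpair.1.unpair.2.unpair.2 := fun n => by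
    simp only [T, Bool.and_eq_true, decide_eq_true_eq]
    rw [← Rat.cast_lt (K := ℝ), ← Rat.cast_lt (K := ℝ)]
    push_cast
    rfl
  ext ⟨r, j, k, r'⟩
  simp only [PolishPresentation.diagram, Set.mem_ofPred_eq, polishPresentation_distance,
    Set.mem_range]
  change (r : ℝ) < i.spectrumDist (s i j) (s i k) ∧ i.spectrumDist (s i j) (s i k) < r' ↔ _
  constructor
  · rintro ⟨h1, h2⟩
    obtain ⟨a, rfl⟩ := ratOfCode_surjective r
    obtain ⟨b, rfl⟩ := ratOfCode_surjective r'
    -- Half of the gap suffices: one `(1 / 2) ^ t` is the error of `q`, the other the safety margin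
    -- in the test.
    obtain ⟨t, ht⟩ := exists_pow_lt_of_lt_one
      (show 0 < min (i.spectrumDist (s i j) (s i k) - ratOfCode a)
        (ratOfCode b - i.spectrumDist (s i j) (s i k)) / 2 by
        have := lt_min (sub_pos.2 h1) (sub_pos.2 h2); positivity)
      (show (1 / 2 : ℝ) < 1 by norm_num)
    have h3 := min_le_left (i.spectrumDist (s i j) (s i k) - ratOfCode a)
      (ratOfCode b - i.spectrumDist (s i j) (s i k))
    have h4 := min_le_right (i.spectrumDist (s i j) (s i k) - ratOfCode a)
      (ratOfCode b - i.spectrumDist (s i j) (s i k))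
    refine ⟨Nat.pair (Nat.pair a (Nat.pair (Nat.pair j k) b)) t, ?_⟩
    have hTt : T i (Nat.pair (Nat.pair a (Nat.pair (Nat.pair j k) b)) t) = true := by
      rw [hTiff]
      simp only [Q, Nat.unpair_pair]
      have h5 := abs_lt.1 (hqs i j k t)
      constructor <;> linarith
    rw [if_pos hTt]
    simp [quadrupleOfCode]
  · rintro ⟨n, hn⟩
    by_cases hTn : T i n = true
    · rw [if_pos hTn] at hn
      rw [hTiff] at hTn
      simp only [quadrupleOfCode, Prod.mk.injEq] at hn
      obtain ⟨h1, h2, h3, h4⟩ := hn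
      simp only [Q, h1, h2, h3, h4] at hTn
      have h5 := abs_lt.1 (hqs i j k n.unpair.2)
      constructor <;> linarith
    · rw [if_neg hTn, hw₀] at hn
      simp only [Prod.mk.injEq] at hn
      obtain ⟨rfl, rfl, rfl, rfl⟩ := hn
      rw [spectrumDist_self]
      norm_num

end NamedAlgebra

/-! ## Total boundedness -/

theorem Nat.pair_le_pair {a a' b b' : ℕ} (ha : a ≤ a') (hb : b ≤ b') :
    Nat.pair a b ≤ Nat.pair a' b' := by
  have h1 : Nat.pair a b ≤ Nat.pair a' b := by
    rcases ha.lt_or_eq with h | rfl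
    · exact (Nat.pair_lt_pair_left b h).le
    · exact le_rfl
  have h2 : Nat.pair a' b ≤ Nat.pair a' b' := by
    rcases hb.lt_or_eq with h | rfl
    · exact (Nat.pair_lt_pair_right a' h).le
    · exact le_rfl
  exact h1.trans h2

/-- A bound on the codes of the sequences of length `m` with entries at most `E`. -/
def codedSeqBound (E m : ℕ) : ℕ := m.rec 0 fun _ r => Nat.pair E r + 1

/-- The code of `a :: s` is `⟨a, code of s⟩ + 1` and pairing is monotone, so bounding the entries
bounds the code. -/
theorem exists_codedSeq_eq_le {v : ℕ → ℕ} {m E : ℕ} (hv : ∀ l < m, v l ≤ E) :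
    ∃ c ≤ codedSeqBound E m, ∀ l < m, codedSeq c l = v l := by
  have key : ∀ s : List ℕ, (∀ a ∈ s, a ≤ E) → Encodable.encode s ≤ codedSeqBound E s.length := by
    intro s hs
    induction s with
    | nil => simp
    | cons a s ih =>
      rw [Encodable.encode_list_cons]
      exact Nat.succ_le_succ (Nat.pair_le_pair (hs a (by simp))
        (ih fun b hb => hs b (by simp [hb])))
  refine ⟨Encodable.encode ((List.range m).map v), ?_, fun l hl => ?_⟩
  · have h := key ((List.range m).map v) (by simpa using hv)
    simpa using h
  · rw [codedSeq_encode, List.getD_eq_getElem _ _ (by simpa using hl)]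
    simp

/-- A real number is approximated by a rational number with a small code. -/
theorem exists_ratOfCode_approx {x : ℝ} {B D : ℕ} (hD : 0 < D) (hx : |x| ≤ B) :
    ∃ a ≤ Nat.pair (Nat.pair (B * D) (B * D)) D, |x - ratOfCode a| ≤ 1 / D := by
  have hD' : (0 : ℝ) < D := Nat.cast_pos.2 hD
  -- The approximation is `⌊x * D⌋ / D`, whose numerator lies between `-(B * D)` and `B * D`.
  set z : ℤ := ⌊x * D⌋ with hz
  rw [abs_le] at hx
  have h1 : (z : ℝ) ≤ x * D := Int.floor_le _
  have h2 : x * D < z + 1 := Int.lt_floor_add_one _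
  have h3 : z ≤ (B * D : ℕ) := by
    have : (z : ℝ) ≤ ((B * D : ℕ) : ℤ) := by push_cast; nlinarith
    exact_mod_cast this
  have h4 : -((B * D : ℕ) : ℤ) ≤ z := by
    rw [hz, Int.le_floor]
    push_cast
    nlinarith
  refine ⟨Nat.pair (Nat.pair z.toNat (-z).toNat) (D - 1),
    Nat.pair_le_pair (Nat.pair_le_pair (by omega) (by omega)) (Nat.sub_le _ _), ?_⟩
  have h5 : ((z.toNat : ℚ)) - (((-z).toNat : ℕ) : ℚ) = (z : ℚ) := by
    have h : ((z.toNat : ℤ)) - (((-z).toNat : ℕ) : ℤ) = z := by omega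
    exact_mod_cast h
  have h6 : ((D - 1 : ℕ) : ℚ) + 1 = (D : ℚ) := by
    have h : D - 1 + 1 = D := Nat.sub_add_cancel hD
    exact_mod_cast h
  simp only [ratOfCode, Nat.unpair_pair]
  rw [h5, h6]
  push_cast
  have h7 : x - z / D = (x * D - z) / D := by field_simp
  rw [h7, abs_div, abs_of_pos hD', div_le_div_iff_of_pos_right hD', abs_le]
  constructor <;> linarith

namespace NamedAlgebra

/-- Computable bounds for the indices of points that come close to all points of the spectrum. -/
theorem exists_index_bound {s : ∀ i : NamedAlgebra.{u}, ℕ → i.Spectrum}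
    (hs : ∀ (i : NamedAlgebra.{u}) m c,
      (∃ φ : i.Spectrum, ∀ l < m, |i.coord l φ - codedRat c l| ≤ (1 / 4) ^ (m + 1)) →
        ∀ l < m, |i.coord l (s i (Nat.pair m c)) - codedRat c l| ≤ 4 * (1 / 2) ^ m) :
    ∃ N : NamedAlgebra.{u} → ℕ → ℕ, IsComputable N ∧
      ∀ (i : NamedAlgebra.{u}) t φ, ∃ k < N i t, i.spectrumDist φ (s i k) < (1 / 2) ^ t := by
  obtain ⟨b, hb, hbspec⟩ := exists_norm_bound.{u}
  have hlt : ∀ {Φ Ψ : NamedAlgebra.{u} → (ℕ × ℕ) × ℕ → ℕ}, IsComputable Φ → IsComputable Ψ →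
      IsComputable fun i a => decide (Φ i a < Ψ i a) := fun hΦ hΨ =>
    hΦ.map₂ (PrimrecRel.decide Primrec.nat_lt).to_comp hΨ
  have hcoord : IsComputable fun (i : NamedAlgebra.{u}) (a : (ℕ × ℕ) × ℕ) => b i (coordPoly a.2) :=
    hb.comp (.map primrec_coordPoly.to_comp UniformComputable.id.snd)
  have hB := (hlt hcoord UniformComputable.id.fst.snd).forall_lt
    (N := fun _ a => a.1) UniformComputable.id.fst
  obtain ⟨B, hBc, hBspec⟩ := UniformComputable.exists_choice hB fun i m =>
    ⟨(Finset.range m).sup (fun l => b i (coordPoly l)) + 1, by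
      simp only [decide_eq_true_eq]
      exact fun l hl => Nat.lt_succ_of_le
        (Finset.le_sup (f := fun l => b i (coordPoly l)) (Finset.mem_range.2 hl))⟩
  simp only [decide_eq_true_eq] at hBspec
  -- Coordinates below `m` are bounded by `B i m`, so `E i m` bounds the codes of their
  -- approximations with denominator `4 ^ (m + 1)`, exactly as precise as `hs` demands.
  let E : NamedAlgebra.{u} → ℕ → ℕ := fun i m =>
    Nat.pair (Nat.pair (B i m * 4 ^ (m + 1)) (B i m * 4 ^ (m + 1))) (4 ^ (m + 1))
  have hpow : IsComputable fun (_ : NamedAlgebra.{u}) (m : ℕ) => 4 ^ (m + 1) :=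
    .natPow (.const 4) (.natAdd .id (.const 1))
  have hE : IsComputable E := .natPair (.natPair (hBc.natMul hpow) (hBc.natMul hpow)) hpow
  have hL : IsComputable fun (i : NamedAlgebra.{u}) m => codedSeqBound (E i m) m := by
    have h := UniformComputable.natRec (.const 0) (Ψ := fun i (p : ℕ × ℕ × ℕ) =>
      Nat.pair (E i p.1) p.2.2 + 1) (.natAdd (.natPair (hE.comp UniformComputable.id.fst)
        UniformComputable.id.snd.snd) (.const 1))
    exact h.comp (UniformComputable.id.pair .id)
  have hm : IsComputable fun (_ : NamedAlgebra.{u}) (t : ℕ) => 2 * t + 8 :=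
    .natAdd (.natMul (.const 2) .id) (.const 8)
  refine ⟨fun i t => Nat.pair (2 * t + 8) (codedSeqBound (E i (2 * t + 8)) (2 * t + 8)) + 1,
    .natAdd (.natPair hm (hL.comp hm)) (.const 1), fun i t φ => ?_⟩
  set m := 2 * t + 8 with hmd
  have hx : ∀ l, ∃ a, l < m → a ≤ E i m ∧ |i.coord l φ - ratOfCode a| ≤ (1 / 4) ^ (m + 1) := by
    intro l
    by_cases hl : l < m
    · have h1 : |i.coord l φ| ≤ B i m := by
        refine (Complex.abs_re_le_norm _).trans ((norm_character_apply_le φ _).trans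
          ((hbspec i _).trans ?_))
        exact_mod_cast (hBspec i m l hl).le
      obtain ⟨a, ha, ha'⟩ := exists_ratOfCode_approx (D := 4 ^ (m + 1)) (by positivity) h1
      refine ⟨a, fun _ => ⟨ha, ha'.trans (le_of_eq ?_)⟩⟩
      rw [one_div_pow]
      push_cast
      rfl
    · exact ⟨0, fun h => absurd h hl⟩
  choose v hv using hx
  obtain ⟨c, hc, hcv⟩ := exists_codedSeq_eq_le fun l hl => (hv l hl).1
  have hφ : ∀ l < m, |i.coord l φ - codedRat c l| ≤ (1 / 4) ^ (m + 1) := fun l hl => by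
    rw [codedRat, hcv l hl]
    exact (hv l hl).2
  refine ⟨Nat.pair m c, Nat.lt_succ_of_le (Nat.pair_le_pair le_rfl hc),
    i.spectrumDist_lt_half_pow fun l hl => ?_⟩
  have h1 := hs i m c ⟨φ, hφ⟩ l hl
  have h2 := hφ l hl
  have h3 : ((1 : ℝ) / 4) ^ (m + 1) ≤ (1 / 2) ^ m :=
    (pow_le_pow_left₀ (by norm_num) (by norm_num) _).trans
      (pow_le_pow_of_le_one (by norm_num) (by norm_num) (Nat.le_succ m))
  have h4 : (0 : ℝ) < (1 / 2) ^ m := by positivity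
  rw [abs_le] at h1 h2 ⊢
  constructor <;> linarith

end NamedAlgebra

/-- The binary digits of `2 ^ N - 1` are ones exactly in the positions below `N`. -/
theorem mem_equivBitIndices_two_pow_sub_one {k N : ℕ} (h : k < N) :
    k ∈ Finset.equivBitIndices (2 ^ N - 1) := by
  simpa using h

theorem mainTheorem6 :
    ∃ M : OracleCode,
      ∀ (A : Type*) [CommCStarAlgebra A] (P : CStarPresentation A) (f : ℕ → ℕ) (n : ℕ),
        P.IsName f →
        Finite (ConnectedComponents (WeakDual.characterSpace ℂ A)) →
        Nat.card (ConnectedComponents (WeakDual.characterSpace ℂ A)) = n →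
        ∃ g h : ℕ → ℕ,
          (∀ k : ℕ, M.eval f (Nat.pair n k) = Part.some (Nat.pair (g k) (h k))) ∧
          ∃ Q : PolishPresentation (WeakDual.characterSpace ℂ A),
            Q.IsName g ∧ Q.IsTotalBoundednessFunction h := by
  obtain ⟨path, hpath, s, hs1, hs2⟩ := NamedAlgebra.exists_points
  obtain ⟨N, hN, hNspec⟩ := NamedAlgebra.exists_index_bound hs2
  obtain ⟨q, hq, hqspec⟩ := NamedAlgebra.exists_dist_approx hpath hs1
  have hdense : ∀ i, DenseRange (s i) := fun i => i.denseRange_of_spectrumDist fun φ t =>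
    (hNspec i t φ).imp fun _ h => h.2
  obtain ⟨g, hg, hgspec⟩ := NamedAlgebra.exists_isName hq hdense hqspec
  -- The finite set for the radius `(1 / 2) ^ t` consists of all indices below `N i t`, coded by `2
  -- ^ N i t - 1`.
  obtain ⟨M, hM⟩ := hg.pair (UniformComputable.natSub (.natPow (.const 2) hN) (.const 1))
  refine ⟨M, fun A _ P f n hf hfin hn => ?_⟩
  let i : NamedAlgebra := ⟨A, P, f, hf, hfin⟩
  refine ⟨g i, fun t => 2 ^ N i t - 1, fun k => ?_, i.polishPresentation (s i) (hdense i),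
    hgspec i, fun t φ => ?_⟩
  · have h := hM i k
    rw [show i.numComponents = n from hn] at h
    exact h
  · obtain ⟨k, hk, hd⟩ := hNspec i t φ
    refine ⟨k, mem_equivBitIndices_two_pow_sub_one hk, ?_⟩
    rw [NamedAlgebra.polishPresentation_distance, ← one_div, ← one_div_pow]
    exact hd
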